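/- A ternary $[n,k,d]$ code is a $k$-dimensional subspace $C$ of $\mathbb{F}_3^n$ whose minimum weight, that is, the smallest number of nonzero coordinates of a nonzero vector of $C$, is exactly $d$. Two ternary codes of length $n$ are equivalent if one can be obtained from the other by permuting the coordinates and changing the signs of certain coordinates, that is, by a map $(x_1,\dots,x_n)\mapsto(\varepsilon_1x_{\sigma(1)},\dots,\varepsilon_nx_{\sigma(n)})$ with $\sigma\in S_n$ and $\varepsilon_1,\dots,\varepsilon_n\in\{1,-1\}$. Proposition. There are exactly $135$ ternary $[10,5,4]$ codes up to equivalence, and there are exactly $1303$ ternary $[10,5,3]$ codes up to equivalence. -/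

import Mathlib

namespace TernaryCode

/-- `d` is the minimum weight of the ternary code `C`: the smallest number of nonzero
coordinates of a nonzero codeword of `C`. -/
def IsMinWeight {n : ℕ} (C : Submodule (ZMod 3) (Fin n → ZMod 3)) (d : ℕ) : Prop :=
  IsLeast {w : ℕ | ∃ c ∈ C, c ≠ 0 ∧ hammingNorm c = w} d

/-- A ternary `[n, k, d]` code: a `k`-dimensional subspace of `𝔽₃ⁿ` with minimum weight `d`. -/
def IsCode (n k d : ℕ) (C : Submodule (ZMod 3) (Fin n → ZMod 3)) : Prop :=
  Module.finrank (ZMod 3) C = k ∧ IsMinWeight C d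

/-- The type of all ternary `[n, k, d]` codes. -/
abbrev Code (n k d : ℕ) : Type :=
  {C : Submodule (ZMod 3) (Fin n → ZMod 3) // IsCode n k d C}

/-- The map `(x₁, …, xₙ) ↦ (ε₁ x_{σ(1)}, …, εₙ x_{σ(n)})` with signs `εᵢ = ±1`. -/
def signedPerm {n : ℕ} (σ : Equiv.Perm (Fin n)) (ε : Fin n → ℤˣ) :
    (Fin n → ZMod 3) →ₗ[ZMod 3] (Fin n → ZMod 3) where
  toFun x i := ((ε i : ℤ) : ZMod 3) * x (σ i)
  map_add' x y := by
    funext i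
    simp [mul_add]
  map_smul' a x := by
    funext i
    simp [mul_left_comm]

/-- Two ternary codes are equivalent if one is obtained from the other by permuting the
coordinates and changing the signs of certain coordinates. -/
def Equivalent {n : ℕ} (C D : Submodule (ZMod 3) (Fin n → ZMod 3)) : Prop :=
  ∃ (σ : Equiv.Perm (Fin n)) (ε : Fin n → ℤˣ), D = C.map (signedPerm σ ε)

theorem signedPerm_comp {n : ℕ} (σ τ : Equiv.Perm (Fin n)) (ε δ : Fin n → ℤˣ) :
    (signedPerm τ δ).comp (signedPerm σ ε)
      = signedPerm (σ * τ) (fun i => δ i * ε (τ i)) := by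
  refine LinearMap.ext fun x => funext fun i => ?_
  simp [signedPerm, mul_assoc]

theorem signedPerm_one {n : ℕ} :
    signedPerm (1 : Equiv.Perm (Fin n)) (fun _ => 1) = LinearMap.id := by
  refine LinearMap.ext fun x => funext fun i => ?_
  simp [signedPerm]

theorem Equivalent.refl {n : ℕ} (C : Submodule (ZMod 3) (Fin n → ZMod 3)) : Equivalent C C :=
  ⟨1, fun _ => 1, by rw [signedPerm_one, Submodule.map_id]⟩

theorem Equivalent.trans {n : ℕ} {C D E : Submodule (ZMod 3) (Fin n → ZMod 3)}
    (h : Equivalent C D) (h' : Equivalent D E) : Equivalent C E := by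
  obtain ⟨σ, ε, rfl⟩ := h
  obtain ⟨τ, δ, rfl⟩ := h'
  exact ⟨σ * τ, fun i => δ i * ε (τ i), by rw [← signedPerm_comp, Submodule.map_comp]⟩

theorem Equivalent.symm {n : ℕ} {C D : Submodule (ZMod 3) (Fin n → ZMod 3)}
    (h : Equivalent C D) : Equivalent D C := by
  obtain ⟨σ, ε, rfl⟩ := h
  refine ⟨σ⁻¹, fun i => ε (σ⁻¹ i), ?_⟩
  rw [← Submodule.map_comp, signedPerm_comp]
  simp [signedPerm_one, Submodule.map_id, Int.units_mul_self]

/-- Equivalence, as an equivalence relation on the ternary `[n, k, d]` codes. -/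
def codeSetoid (n k d : ℕ) : Setoid (Code n k d) where
  r C D := Equivalent C.1 D.1
  iseqv := ⟨fun C => Equivalent.refl C.1, Equivalent.symm, Equivalent.trans⟩

/-- The set of equivalence classes of ternary `[n, k, d]` codes. -/
abbrev CodeClass (n k d : ℕ) : Type := Quotient (codeSetoid n k d)

end TernaryCode

/-!
Counting the parity-check matrices of codes of length `10`, dimension `5` and minimum weight at
least `3`, whose columns represent distinct points of a projective space, and dividing by
`|GL₅(𝔽₃)|` shows that there are at most `987813872640` such codes. A list of `1439` codes with
distinct invariants, namely sums of third moments of weight enumerators, supplies as many different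
orbits of the group of signed coordinate permutations. The order of each stabilizer is bounded by
counting, one coordinate after the other, the signed coordinates to which it can be mapped, given
the images of the previous ones. The resulting lower bounds for the sizes of the orbits add up to
`987813872640`, so there are no other orbits.

The kernel evaluates the enumerators for all `243` words of a code at once, on natural numbers
divided into lanes of `32` bits.
-/

namespace TernaryCode
open scoped Pointwise

section GroupActions

theorem card_le_prod_card_of_base {G α : Type*} [Group G] [MulAction G α] [Finite G] {n : ℕ}
    (b : Fin n → α) (T : Fin n → Finset α)
    (hT : ∀ i (g : G), (∀ k < i, g • b k = b k) → g • b i ∈ T i)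
    (hb : ∀ g : G, (∀ k, g • b k = b k) → g = 1) :
    Nat.card G ≤ ∏ i, (T i).card := by
  induction n generalizing G with
  | zero =>
    have : Subsingleton G := ⟨fun g h => (hb g finZeroElim).trans (hb h finZeroElim).symm⟩
    simp
  | succ n ih =>
    rw [← (MulAction.stabilizer G (b 0)).index_mul_card, MulAction.index_stabilizer,
      Fin.prod_univ_succ]
    refine Nat.mul_le_mul ?_ (ih (Fin.tail b) (Fin.tail T) ?_ ?_)
    · rw [← Set.ncard_coe_finset]
      refine Set.ncard_le_ncard ?_ (T 0).finite_toSet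
      rintro _ ⟨g, rfl⟩
      exact hT 0 g fun k hk => absurd hk (Fin.not_lt_zero k)
    · intro i g hg
      refine hT i.succ g fun k hk => ?_
      cases k using Fin.cases with
      | zero => exact g.2
      | succ k => exact hg k (Fin.succ_lt_succ_iff.1 hk)
    · exact fun g hg => Subtype.ext (hb g (Fin.cases g.2 hg))

theorem exists_smul_eq_of_ncard_le {G α ι : Type*} [Group G] [MulAction G α] [Finite G]
    [Fintype ι] {A : Set α} (hA : A.Finite) (hGA : ∀ (g : G), ∀ x ∈ A, g • x ∈ A)
    (x : ι → α) (hx : ∀ i, x i ∈ A) (hxx : ∀ i j (g : G), g • x i = x j → i = j)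
    (m : ι → ℕ) (hm : ∀ i, Nat.card (MulAction.stabilizer G (x i)) ≤ m i)
    (hmass : A.ncard ≤ ∑ i, Nat.card G / m i) {y : α} (hy : y ∈ A) :
    ∃ i, ∃ g : G, g • x i = y := by
  have hfin : ∀ i, (MulAction.orbit G (x i)).Finite := fun i => Set.finite_range _
  have hsub : ⋃ i, MulAction.orbit G (x i) ⊆ A := by
    rintro _ hy
    obtain ⟨i, g, rfl⟩ := Set.mem_iUnion.1 hy
    exact hGA g _ (hx i)
  have hdisj : Pairwise (Function.onFun Disjoint fun i => MulAction.orbit G (x i)) := by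
    intro i j hij
    refine Set.disjoint_left.2 ?_
    rintro _ ⟨g, rfl⟩ ⟨g', h⟩
    exact hij (hxx i j (g'⁻¹ * g) (by rw [mul_smul, inv_smul_eq_iff]; exact h.symm))
  have horbit : ∀ i, Nat.card G / m i ≤ (MulAction.orbit G (x i)).ncard := fun i =>
    Nat.div_le_of_le_mul <| by
      rw [← (MulAction.stabilizer G (x i)).index_mul_card, MulAction.index_stabilizer, mul_comm]
      exact Nat.mul_le_mul_right _ (hm i)
  have hcard : A.ncard ≤ (⋃ i, MulAction.orbit G (x i)).ncard := by
    rw [Set.ncard_iUnion_of_finite hfin hdisj, finsum_eq_sum_of_fintype]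
    exact hmass.trans (Finset.sum_le_sum fun i _ => horbit i)
  rw [← Set.eq_of_subset_of_ncard_le hsub hcard hA] at hy
  obtain ⟨i, g, h⟩ := Set.mem_iUnion.1 hy
  exact ⟨i, g, h⟩

end GroupActions

section SignedPermutations

variable {n : ℕ}

/-- The group of signed coordinate permutations of `𝔽₃ⁿ`. -/
def signedPermGroup (n : ℕ) :
    Subgroup ((Fin n → ZMod 3) ≃ₗ[ZMod 3] (Fin n → ZMod 3)) where
  carrier := {g | ∃ σ ε, g.toLinearMap = signedPerm σ ε}
  one_mem' := ⟨1, fun _ => 1, signedPerm_one.symm⟩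
  mul_mem' := by
    rintro g h ⟨σ, ε, hg⟩ ⟨τ, δ, hh⟩
    refine ⟨_, _, Eq.trans ?_ (signedPerm_comp τ σ δ ε)⟩
    rw [← hg, ← hh]
    rfl
  inv_mem' := by
    rintro g ⟨σ, ε, hg⟩
    refine ⟨σ⁻¹, fun i => ε (σ⁻¹ i), LinearMap.ext fun x => ?_⟩
    change g.symm x = _
    rw [LinearEquiv.symm_apply_eq, ← LinearEquiv.coe_coe, hg, ← LinearMap.comp_apply,
      signedPerm_comp]
    simp [signedPerm_one, Int.units_mul_self]

-- A shortcut: the search for this instance first tries the entrywise actions on the Pi type.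
instance : SMul (signedPermGroup n) (Fin n → ZMod 3) :=
  inferInstance

/-- The signed coordinate permutation `signedPerm σ ε` as an element of the group. -/
def signedPermGroup.mk (σ : Equiv.Perm (Fin n)) (ε : Fin n → ℤˣ) : signedPermGroup n :=
  ⟨.ofLinearMap (signedPerm σ ε) (signedPerm σ⁻¹ fun i => ε (σ⁻¹ i))
    (by rw [signedPerm_comp]; simp [signedPerm_one, Int.units_mul_self])
    (by rw [signedPerm_comp]; simp [signedPerm_one, Int.units_mul_self]), σ, ε, rfl⟩

theorem signedPermGroup.mk_smul (σ : Equiv.Perm (Fin n)) (ε : Fin n → ℤˣ)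
    (x : Fin n → ZMod 3) (i : Fin n) : (mk σ ε • x) i = ((ε i : ℤ) : ZMod 3) * x (σ i) :=
  rfl

theorem signedPermGroup.exists_eq_mk (g : signedPermGroup n) : ∃ σ ε, g = mk σ ε := by
  obtain ⟨g, σ, ε, h⟩ := g
  exact ⟨σ, ε, Subtype.ext (LinearEquiv.toLinearMap_injective h)⟩

instance : Finite (signedPermGroup n) :=
  .of_surjective (fun p : Equiv.Perm (Fin n) × (Fin n → ℤˣ) => signedPermGroup.mk p.1 p.2)
    fun g => let ⟨σ, ε, h⟩ := signedPermGroup.exists_eq_mk g; ⟨(σ, ε), h.symm⟩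

theorem signedPermGroup.mk_injective : Function.Injective
    fun p : Equiv.Perm (Fin n) × (Fin n → ℤˣ) => mk p.1 p.2 := by
  rintro ⟨σ, ε⟩ ⟨τ, δ⟩ h
  have hunit : ∀ s t : ℤˣ, ((s : ℤ) : ZMod 3) = ((t : ℤ) : ZMod 3) → s = t := by decide
  have happly : ∀ (x : Fin n → ZMod 3) i,
      ((ε i : ℤ) : ZMod 3) * x (σ i) = ((δ i : ℤ) : ZMod 3) * x (τ i) := fun x i =>
    congrFun (congrArg (fun g : signedPermGroup n => g • x) h) i
  have hσ : σ = τ := Equiv.ext fun i => by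
    have hne : ∀ s : ℤˣ, ((s : ℤ) : ZMod 3) ≠ 0 := by decide
    by_contra hi
    exact hne (ε i) (by simpa [Pi.single_eq_of_ne' hi] using happly (Pi.single (σ i) 1) i)
  have hε : ε = δ := funext fun i => hunit _ _ (by simpa using happly 1 i)
  rw [hσ, hε]

theorem card_signedPermGroup (n : ℕ) :
    Nat.card (signedPermGroup n) = n.factorial * 2 ^ n := by
  rw [← Nat.card_congr (.ofBijective _ ⟨signedPermGroup.mk_injective, fun g =>
    let ⟨σ, ε, h⟩ := signedPermGroup.exists_eq_mk g
    ⟨(σ, ε), h.symm⟩⟩)]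
  simp [Fintype.card_perm]

theorem equivalent_iff_exists_smul_eq {C D : Submodule (ZMod 3) (Fin n → ZMod 3)} :
    Equivalent C D ↔ ∃ g : signedPermGroup n, g • C = D := by
  constructor
  · rintro ⟨σ, ε, rfl⟩
    exact ⟨signedPermGroup.mk σ ε, rfl⟩
  · rintro ⟨g, rfl⟩
    obtain ⟨σ, ε, rfl⟩ := signedPermGroup.exists_eq_mk g
    exact ⟨σ, ε, rfl⟩

theorem dotProduct_smul_smul (g : signedPermGroup n) (x y : Fin n → ZMod 3) :
    (g • x) ⬝ᵥ (g • y) = x ⬝ᵥ y := by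
  obtain ⟨σ, ε, rfl⟩ := signedPermGroup.exists_eq_mk g
  have hsq : ∀ s : ℤˣ, ((s : ℤ) : ZMod 3) * ((s : ℤ) : ZMod 3) = 1 := by decide
  simp only [dotProduct, signedPermGroup.mk_smul, mul_mul_mul_comm, hsq, one_mul]
  exact Equiv.sum_comp σ fun i => x i * y i

theorem hammingNorm_smul (g : signedPermGroup n) (x : Fin n → ZMod 3) :
    hammingNorm (g • x) = hammingNorm x := by
  obtain ⟨σ, ε, rfl⟩ := signedPermGroup.exists_eq_mk g
  have hmul : ∀ (s : ℤˣ) (t : ZMod 3), ((s : ℤ) : ZMod 3) * t ≠ 0 ↔ t ≠ 0 := by decide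
  simp only [hammingNorm, Finset.card_filter, signedPermGroup.mk_smul, hmul]
  exact Equiv.sum_comp σ fun i => if x i ≠ 0 then 1 else 0

theorem smul_mem_smul_iff {g : signedPermGroup n} {C : Submodule (ZMod 3) (Fin n → ZMod 3)}
    {x : Fin n → ZMod 3} : g • x ∈ g • C ↔ x ∈ C :=
  Set.smul_mem_smul_set_iff (s := (C : Set (Fin n → ZMod 3)))

theorem hammingNorm_single (i : Fin n) {x : ZMod 3} (hx : x ≠ 0) :
    hammingNorm (Pi.single i x : Fin n → ZMod 3) = 1 := by
  simp [hammingNorm, Pi.single_apply, Finset.filter_eq', hx]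

end SignedPermutations

section Enumerators

variable {n : ℕ} (g : signedPermGroup n) (C : Submodule (ZMod 3) (Fin n → ZMod 3))

open Classical in
/-- The weight enumerator of a set of words, evaluated at `2`. -/
noncomputable def enumerator (S : Set (Fin n → ZMod 3)) : ℕ :=
  ∑ c with c ∈ S, 2 ^ hammingNorm c

theorem enumerator_smul (S : Set (Fin n → ZMod 3)) : enumerator (g • S) = enumerator S := by
  classical
  simp only [enumerator, Finset.sum_filter]
  rw [← Equiv.sum_comp (MulAction.toPerm g)]
  simp only [MulAction.toPerm_apply, Set.smul_mem_smul_set_iff, hammingNorm_smul]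

/-- The enumerator of the codewords with coordinates `u` and `v` both equal to `1`. Here and below
a word `u` of weight one stands for a signed coordinate, whose value at `c` is `u ⬝ᵥ c`. -/
noncomputable def pairEnumerator (u v : Fin n → ZMod 3) : ℕ :=
  enumerator {c | c ∈ C ∧ u ⬝ᵥ c = 1 ∧ v ⬝ᵥ c = 1}

/-- The third moment of the pair enumerators of the signed coordinate `u`. -/
noncomputable def moment (u : Fin n → ZMod 3) : ℕ :=
  ∑ v with hammingNorm v = 1, pairEnumerator C u v ^ 3

/-- The sum of the moments of all signed coordinates, which separates the codes of
`mainTheorem2`. -/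
noncomputable def momentSum : ℕ := ∑ u with hammingNorm u = 1, moment C u

/-- The enumerator of the codewords with signed coordinate `u` equal to `1` and with the same
first `i` entries as `a`. -/
noncomputable def prefixEnumerator (i : ℕ) (a u : Fin n → ZMod 3) : ℕ :=
  enumerator {c | c ∈ C ∧ u ⬝ᵥ c = 1 ∧ ∀ k : Fin n, (k : ℕ) < i → c k = a k}

theorem sum_hammingNorm_eq_one_smul (f : (Fin n → ZMod 3) → ℕ) :
    ∑ v with hammingNorm v = 1, f (g • v) = ∑ v with hammingNorm v = 1, f v := by
  simp only [Finset.sum_filter]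
  rw [← Equiv.sum_comp (MulAction.toPerm g)
    fun v : Fin n → ZMod 3 => if hammingNorm v = 1 then f v else 0]
  simp only [MulAction.toPerm_apply, hammingNorm_smul]

theorem pairEnumerator_smul (u v : Fin n → ZMod 3) :
    pairEnumerator (g • C) (g • u) (g • v) = pairEnumerator C u v := by
  rw [pairEnumerator, pairEnumerator, ← enumerator_smul g {c | c ∈ C ∧ _}]
  congr 1
  ext c
  obtain ⟨c, rfl⟩ := MulAction.surjective g c
  simp only [Set.mem_ofPred_eq, Set.smul_mem_smul_set_iff, smul_mem_smul_iff,
    dotProduct_smul_smul]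

theorem moment_smul (u : Fin n → ZMod 3) : moment (g • C) (g • u) = moment C u := by
  rw [moment, moment, ← sum_hammingNorm_eq_one_smul g]
  simp only [pairEnumerator_smul]

theorem momentSum_smul : momentSum (g • C) = momentSum C := by
  rw [momentSum, momentSum, ← sum_hammingNorm_eq_one_smul g]
  simp only [moment_smul]

theorem moment_neg (u : Fin n → ZMod 3) : moment C (-u) = moment C u := by
  let ν : signedPermGroup n := signedPermGroup.mk 1 fun _ => -1
  have hν : ∀ x : Fin n → ZMod 3, ν • x = -x := fun x => funext fun i => by
    simp [ν, signedPermGroup.mk_smul]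
  have hC : ν • C = C := Submodule.ext fun c => by
    rw [← neg_mem_iff, ← hν, smul_mem_smul_iff]
  rw [← hν, ← moment_smul ν C u, hC]

variable {C g}

theorem prefixEnumerator_smul {i : ℕ} (hC : g • C = C)
    (hg : ∀ k : Fin n, (k : ℕ) < i →
      g • (Pi.single k 1 : Fin n → ZMod 3) = Pi.single k 1) (a u : Fin n → ZMod 3) :
    prefixEnumerator C i a (g • u) = prefixEnumerator C i a u := by
  have hentry : ∀ (c : Fin n → ZMod 3) (k : Fin n), (k : ℕ) < i → (g • c) k = c k :=
    fun c k hk => by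
      rw [← single_one_dotProduct k (g • c), ← hg k hk, dotProduct_smul_smul,
        single_one_dotProduct]
  rw [prefixEnumerator, prefixEnumerator, ← enumerator_smul g {c | c ∈ C ∧ u ⬝ᵥ c = 1 ∧ _}]
  congr 1
  ext c
  obtain ⟨c, rfl⟩ := MulAction.surjective g c
  have hmem : g • c ∈ C ↔ c ∈ C := by
    conv_lhs => rw [← hC]
    exact smul_mem_smul_iff
  simp +contextual only [Set.mem_ofPred_eq, Set.smul_mem_smul_set_iff, dotProduct_smul_smul, hmem,
    hentry]

variable (C)

open Classical in
/-- The signed coordinates that the enumerators of `C` do not separate from the `i`-th coordinate,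
when the coordinates before `i` are fixed. -/
noncomputable def candidates (i : Fin n) : Finset (Fin n → ZMod 3) :=
  {u | hammingNorm u = 1 ∧ (∀ k < i, u k = 0) ∧ moment C u = moment C (Pi.single i 1) ∧
    ∀ a ∈ C, prefixEnumerator C i a u = prefixEnumerator C i a (Pi.single i 1)}

variable {C}

theorem mem_candidates_iff {i : Fin n} {u : Fin n → ZMod 3} : u ∈ candidates C i ↔
    hammingNorm u = 1 ∧ (∀ k < i, u k = 0) ∧ moment C u = moment C (Pi.single i 1) ∧
      ∀ a ∈ C, prefixEnumerator C i a u = prefixEnumerator C i a (Pi.single i 1) := by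
  classical
  rw [candidates, Finset.mem_filter_univ]

theorem smul_single_mem_candidates {i : Fin n} (hC : g • C = C)
    (hg : ∀ k < i, g • (Pi.single k 1 : Fin n → ZMod 3) = Pi.single k 1) :
    g • Pi.single i 1 ∈ candidates C i := by
  refine mem_candidates_iff.2 ⟨?_, fun k hk => ?_, ?_, fun a _ => ?_⟩
  · rw [hammingNorm_smul, hammingNorm_single i one_ne_zero]
  · rw [← single_one_dotProduct k (g • _), ← hg k hk, dotProduct_smul_smul]
    simp [hk.ne]
  · exact (congrArg (moment · _) hC).symm.trans (moment_smul g C _)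
  · exact prefixEnumerator_smul hC hg a _

variable (C)

theorem card_stabilizer_le_prod_card_candidates :
    Nat.card (MulAction.stabilizer (signedPermGroup n) C) ≤ ∏ i, (candidates C i).card := by
  refine card_le_prod_card_of_base (fun k => (Pi.single k 1 : Fin n → ZMod 3)) _
    (fun i g hg => smul_single_mem_candidates g.2 hg) fun g hg => Subtype.ext (Subtype.ext ?_)
  refine LinearEquiv.toLinearMap_injective ((Pi.basisFun (ZMod 3) (Fin n)).ext fun k => ?_)
  rw [Pi.basisFun_apply]
  exact hg k

end Enumerators

section ProjectiveTuples

variable {V : Type*} [AddCommGroup V] {k : ℕ}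

/-- The entries of `x` represent distinct points of a projective space over `𝔽₃`, in which a point
is a pair `{v, -v}` with `v ≠ 0`. -/
def IsProjective (x : Fin k → V) : Prop :=
  (∀ i, x i ≠ 0) ∧ ∀ i j, i ≠ j → x i ≠ x j ∧ x i ≠ -x j

theorem ne_neg_self_of_ne_zero [Module (ZMod 3) V] {v : V} (hv : v ≠ 0) : v ≠ -v := by
  intro h
  have h2 : (2 : ZMod 3) • v = 0 := by rw [two_smul, ← eq_neg_iff_add_eq_zero, ← h]
  exact hv ((smul_eq_zero.1 h2).resolve_left (by decide))

/-- The vectors excluded as a further entry of the projective tuple `x`. -/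
def excluded [DecidableEq V] (x : Fin k → V) : Finset V :=
  insert 0 (Finset.univ.image x ∪ Finset.univ.image (-x))

theorem mem_excluded [DecidableEq V] {x : Fin k → V} {v : V} :
    v ∈ excluded x ↔ v = 0 ∨ ∃ i, v = x i ∨ v = -x i := by
  simp [excluded, exists_or, eq_comm]

theorem IsProjective.card_excluded [DecidableEq V] [Module (ZMod 3) V] {x : Fin k → V}
    (hx : IsProjective x) : (excluded x).card = 2 * k + 1 := by
  have hinj : Function.Injective x := fun i j h => not_imp_not.1 (fun hij => (hx.2 i j hij).1) h
  have hdisj : Disjoint (Finset.univ.image x) (Finset.univ.image (-x)) := by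
    simp only [Finset.disjoint_left, Finset.mem_image, Finset.mem_univ, true_and, not_exists]
    rintro _ ⟨i, rfl⟩ j h
    rcases eq_or_ne i j with rfl | hij
    · exact ne_neg_self_of_ne_zero (hx.1 i) h.symm
    · exact (hx.2 i j hij).2 h.symm
  have hneg : Function.Injective (-x) := neg_injective.comp hinj
  rw [excluded, Finset.card_insert_of_notMem, Finset.card_union_of_disjoint hdisj,
    Finset.card_image_of_injective _ hinj, Finset.card_image_of_injective _ hneg,
    Finset.card_fin, two_mul]
  simp [hx.1]

theorem isProjective_cons [DecidableEq V] {v : V} {x : Fin k → V} :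
    IsProjective (Fin.cons v x : Fin (k + 1) → V) ↔ IsProjective x ∧ v ∉ excluded x := by
  simp only [IsProjective, mem_excluded, Fin.forall_fin_succ, Fin.cons_zero, Fin.cons_succ, ne_eq,
    Fin.succ_inj, not_or, not_exists]
  constructor
  · rintro ⟨⟨h1, h2⟩, ⟨-, h3⟩, h4⟩
    exact ⟨⟨h2, fun i => (h4 i).2⟩, h1, fun i => h3 i (Fin.succ_ne_zero i).symm⟩
  · rintro ⟨⟨h2, h4⟩, h1, h3⟩
    refine ⟨⟨h1, h2⟩, ⟨fun h => absurd trivial h, fun i _ => h3 i⟩, fun i => ⟨fun _ => ?_, h4 i⟩⟩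
    exact ⟨fun h => (h3 i).1 h.symm, fun h => (h3 i).2 (by rw [h, neg_neg])⟩

variable [Module (ZMod 3) V]

/-- The span of the entries of `x`. -/
abbrev rangeSpan (x : Fin k → V) : Submodule (ZMod 3) V :=
  Submodule.span (ZMod 3) (Set.range x)

theorem rangeSpan_cons (v : V) (x : Fin k → V) :
    rangeSpan (Fin.cons v x : Fin (k + 1) → V) = rangeSpan x ⊔ Submodule.span (ZMod 3) {v} := by
  rw [rangeSpan, Fin.range_cons, Submodule.span_insert, sup_comm]

theorem excluded_subset_rangeSpan [DecidableEq V] (x : Fin k → V) :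
    (excluded x : Set V) ⊆ rangeSpan x := by
  intro v hv
  have hmem : ∀ i, x i ∈ rangeSpan x := fun i => Submodule.subset_span ⟨i, rfl⟩
  obtain rfl | ⟨i, rfl | rfl⟩ := mem_excluded.1 hv
  exacts [Submodule.zero_mem _, hmem i, Submodule.neg_mem _ (hmem i)]

/-- A bound for the number of projective `k`-tuples of rank `r` in a space of dimension `m`: such a
tuple arises by adding to a shorter one either a vector of its span or a vector outside. -/
def tupleCount (m : ℕ) : ℕ → ℕ → ℕ
  | 0, 0 => 1
  | 0, _ + 1 => 0
  | _ + 1, 0 => 0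
  | k + 1, r + 1 => tupleCount m k (r + 1) * (3 ^ (r + 1) - (2 * k + 1))
      + tupleCount m k r * (3 ^ m - 3 ^ r)

variable [Fintype V]

open Classical in
/-- The projective `k`-tuples that span a subspace of dimension `r`. -/
noncomputable def projectiveTuples (V : Type*) [AddCommGroup V] [Module (ZMod 3) V] [Fintype V]
    (k r : ℕ) : Finset (Fin k → V) :=
  {x | IsProjective x ∧ Module.finrank (ZMod 3) (rangeSpan x) = r}

theorem mem_projectiveTuples {r : ℕ} {x : Fin k → V} : x ∈ projectiveTuples V k r ↔
    IsProjective x ∧ Module.finrank (ZMod 3) (rangeSpan x) = r := by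
  simp [projectiveTuples]

open Classical in
theorem card_submodule_filter (W : Submodule (ZMod 3) V) :
    (Finset.univ.filter (· ∈ W)).card = 3 ^ Module.finrank (ZMod 3) W := by
  rw [← Fintype.card_subtype, ← Nat.card_eq_fintype_card,
    Module.natCard_eq_pow_finrank (K := ZMod 3), Nat.card_zmod]

open Classical in
theorem projectiveTuples_succ_succ_subset (k r : ℕ) :
    projectiveTuples V (k + 1) (r + 1) ⊆
      ((projectiveTuples V k (r + 1)).sigma fun x =>
        Finset.univ.filter (· ∈ rangeSpan x) \ excluded x).image (fun p => Fin.cons p.2 p.1) ∪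
      ((projectiveTuples V k r).sigma fun x =>
        (Finset.univ.filter (· ∈ rangeSpan x))ᶜ).image (fun p => Fin.cons p.2 p.1) := by
  intro y hy
  obtain ⟨v, x, rfl⟩ : ∃ v x, y = Fin.cons v x := ⟨_, _, (Fin.cons_self_tail y).symm⟩
  simp only [Finset.mem_union, Finset.mem_image, Finset.mem_sigma, Sigma.exists, Finset.mem_sdiff,
    Finset.mem_compl, Finset.mem_filter_univ, mem_projectiveTuples] at hy ⊢
  obtain ⟨hproj, hrank⟩ := hy
  obtain ⟨hx, hv⟩ := isProjective_cons.1 hproj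
  rw [rangeSpan_cons] at hrank
  by_cases hmem : v ∈ rangeSpan x
  · rw [sup_eq_left.2 ((Submodule.span_singleton_le_iff_mem _ _).2 hmem)] at hrank
    exact .inl ⟨x, v, ⟨⟨hx, hrank⟩, hmem, hv⟩, rfl⟩
  · rw [Submodule.finrank_sup_span_singleton hmem] at hrank
    exact .inr ⟨x, v, ⟨⟨hx, Nat.succ.inj hrank⟩, hmem⟩, rfl⟩

theorem projectiveTuples_succ_zero (k : ℕ) : projectiveTuples V (k + 1) 0 = ∅ := by
  refine Finset.eq_empty_of_forall_notMem fun x hx => ?_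
  obtain ⟨hproj, hrank⟩ := mem_projectiveTuples.1 hx
  refine hproj.1 0 ((Submodule.eq_bot_iff _).1 (Submodule.finrank_eq_zero.1 hrank) _ ?_)
  exact Submodule.subset_span ⟨0, rfl⟩

theorem card_projectiveTuples_le (k r : ℕ) :
    (projectiveTuples V k r).card ≤ tupleCount (Module.finrank (ZMod 3) V) k r := by
  classical
  induction k generalizing r with
  | zero =>
    cases r with
    | zero => exact (Finset.card_le_univ _).trans (by simp [tupleCount])
    | succ r =>
      refine (Finset.card_eq_zero.2 (Finset.filter_eq_empty_iff.2 ?_)).le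
      rintro x - ⟨-, hrank⟩
      rw [rangeSpan, Set.range_eq_empty, Submodule.span_empty, finrank_bot] at hrank
      omega
  | succ k ih =>
    cases r with
    | zero => simp [projectiveTuples_succ_zero]
    | succ r =>
      refine (Finset.card_le_card (projectiveTuples_succ_succ_subset k r)).trans
        ((Finset.card_union_le _ _).trans (Nat.add_le_add ?_ ?_))
      · refine Finset.card_image_le.trans (le_trans (le_of_eq ?_) (Nat.mul_le_mul_right _ (ih _)))
        rw [Finset.card_sigma, Finset.sum_const_nat]
        intro x hx
        obtain ⟨hproj, hrank⟩ := mem_projectiveTuples.1 hx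
        have hsub : excluded x ⊆ Finset.univ.filter (· ∈ rangeSpan x) := fun v hv =>
          (Finset.mem_filter_univ v).2 (excluded_subset_rangeSpan x hv)
        rw [Finset.card_sdiff_of_subset hsub, card_submodule_filter, hrank, hproj.card_excluded]
      · refine Finset.card_image_le.trans (le_trans (le_of_eq ?_) (Nat.mul_le_mul_right _ (ih _)))
        rw [Finset.card_sigma, Finset.sum_const_nat]
        intro x hx
        rw [Finset.card_compl, card_submodule_filter, (mem_projectiveTuples.1 hx).2,
          ← Nat.card_eq_fintype_card, Module.natCard_eq_pow_finrank (K := ZMod 3), Nat.card_zmod]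

end ProjectiveTuples

section CountingCodes

variable {V : Type*} [AddCommGroup V] [Module (ZMod 3) V] {n : ℕ}

/-- The nonzero words of `C` have weight at least `d`. -/
def HasMinWeightGE (C : Submodule (ZMod 3) (Fin n → ZMod 3)) (d : ℕ) : Prop :=
  ∀ c ∈ C, c ≠ 0 → d ≤ hammingNorm c

/-- The codes of length `n` and dimension `k` whose nonzero words have weight at least `d`. -/
def codesGE (n k d : ℕ) : Set (Submodule (ZMod 3) (Fin n → ZMod 3)) :=
  {C | Module.finrank (ZMod 3) C = k ∧ HasMinWeightGE C d}

theorem hammingNorm_single_le (i : Fin n) (a : ZMod 3) :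
    hammingNorm (Pi.single i a : Fin n → ZMod 3) ≤ 1 := by
  rw [hammingNorm, ← Finset.card_singleton i]
  refine Finset.card_le_card fun j hj => Finset.mem_singleton.2 ?_
  by_contra hij
  exact (Finset.mem_filter.1 hj).2 (Pi.single_eq_of_ne (M := fun _ => ZMod 3) hij a)

/-- The images of the unit vectors under `φ`. If `C` is the kernel of `φ`, they are the columns of a
parity check matrix of `C`. -/
def columns (φ : (Fin n → ZMod 3) →ₗ[ZMod 3] V) (j : Fin n) : V :=
  φ (Pi.single j 1)

theorem columns_injective : Function.Injective (columns (V := V) (n := n)) := fun φ ψ h =>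
  (Pi.basisFun (ZMod 3) (Fin n)).ext fun j => by
    rw [Pi.basisFun_apply]
    exact congrFun h j

theorem rangeSpan_columns (φ : (Fin n → ZMod 3) →ₗ[ZMod 3] V) :
    rangeSpan (columns φ) = LinearMap.range φ := by
  rw [LinearMap.range_eq_map, ← (Pi.basisFun (ZMod 3) (Fin n)).span_eq, Submodule.map_span,
    ← Set.range_comp]
  congr 2
  ext j
  simp [columns]

theorem isProjective_columns {φ : (Fin n → ZMod 3) →ₗ[ZMod 3] V}
    (hφ : HasMinWeightGE (LinearMap.ker φ) 3) : IsProjective (columns φ) := by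
  have hcomb : ∀ i j (a b : ZMod 3), a • columns φ i + b • columns φ j = 0 →
      (Pi.single i a + Pi.single j b : Fin n → ZMod 3) = 0 := fun i j a b h => by
    by_contra hne
    have hker : (Pi.single i a + Pi.single j b : Fin n → ZMod 3) ∈ LinearMap.ker φ := by
      rw [LinearMap.mem_ker, ← h]
      simp [columns, ← map_smul, ← Pi.single_smul]
    have hle := hammingDist_triangle (-Pi.single i a : Fin n → ZMod 3) 0 (Pi.single j b)
    rw [hammingDist_eq_hammingNorm, neg_neg, hammingDist_zero_right, hammingDist_zero_left,
      ← Pi.single_neg] at hle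
    have := hφ _ hker hne
    have := hammingNorm_single_le i (-a)
    have := hammingNorm_single_le j b
    omega
  refine ⟨fun i h => ?_, fun i j hij => ⟨fun h => ?_, fun h => ?_⟩⟩
  · simpa using congrFun (hcomb i i 1 0 (by simp [h])) i
  · simpa [hij] using congrFun (hcomb i j 1 (-1) (by simp [h])) i
  · simpa [hij] using congrFun (hcomb i j 1 1 (by simp [h])) i

theorem exists_surjective_ker_eq [Module.Finite (ZMod 3) V]
    (C : Submodule (ZMod 3) (Fin n → ZMod 3))
    (hC : Module.finrank (ZMod 3) V + Module.finrank (ZMod 3) C = n) :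
    ∃ φ : (Fin n → ZMod 3) →ₗ[ZMod 3] V, Function.Surjective φ ∧ LinearMap.ker φ = C := by
  have hrank : Module.finrank (ZMod 3) ((Fin n → ZMod 3) ⧸ C) = Module.finrank (ZMod 3) V := by
    have := C.finrank_quotient_add_finrank
    rw [Module.finrank_fin_fun] at this
    omega
  let e := LinearEquiv.ofFinrankEq _ _ hrank
  refine ⟨e.toLinearMap ∘ₗ C.mkQ, e.surjective.comp C.mkQ_surjective, ?_⟩
  rw [LinearMap.ker_comp_of_ker_eq_bot _ e.ker, C.ker_mkQ]

theorem ncard_codesGE_three_mul_card_linearEquiv_le [Finite V] {k : ℕ}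
    (hn : Module.finrank (ZMod 3) V + k = n) :
    (codesGE n k 3).ncard * Nat.card (V ≃ₗ[ZMod 3] V) ≤
      tupleCount (Module.finrank (ZMod 3) V) n (Module.finrank (ZMod 3) V) := by
  have := Fintype.ofFinite V
  refine le_trans ?_ (card_projectiveTuples_le n _)
  choose φ hsurj hker using fun C : codesGE n k 3 =>
    exists_surjective_ker_eq (V := V) C.1 (C.2.1.symm ▸ hn)
  have hker' : ∀ (C : codesGE n k 3) (g : V ≃ₗ[ZMod 3] V),
      LinearMap.ker (g.toLinearMap ∘ₗ φ C) = C.1 := fun C g =>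
    (LinearMap.ker_comp_of_ker_eq_bot _ g.ker).trans (hker C)
  have hrange : ∀ (C : codesGE n k 3) (g : V ≃ₗ[ZMod 3] V),
      LinearMap.range (g.toLinearMap ∘ₗ φ C) = ⊤ := fun C g =>
    LinearMap.range_eq_top.2 (g.surjective.comp (hsurj C))
  let F : codesGE n k 3 × (V ≃ₗ[ZMod 3] V) →
      projectiveTuples V n (Module.finrank (ZMod 3) V) := fun p =>
    ⟨columns (p.2.toLinearMap ∘ₗ φ p.1), mem_projectiveTuples.2
      ⟨isProjective_columns ((hker' p.1 p.2).symm ▸ p.1.2.2),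
        by rw [rangeSpan_columns, hrange, finrank_top]⟩⟩
  have hF : Function.Injective F := by
    rintro ⟨C, g⟩ ⟨D, h⟩ heq
    have hcomp : g.toLinearMap ∘ₗ φ C = h.toLinearMap ∘ₗ φ D :=
      columns_injective (congrArg Subtype.val heq)
    obtain rfl : C = D := Subtype.ext (by rw [← hker' C g, hcomp, hker'])
    have hgh : g.toLinearMap = h.toLinearMap := (LinearMap.cancel_right (hsurj C)).1 hcomp
    rw [LinearEquiv.toLinearMap_injective hgh]
  rw [← Nat.card_coe_set_eq, ← Nat.card_prod, ← Fintype.card_coe, ← Nat.card_eq_fintype_card]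
  exact Nat.card_le_card_of_injective F hF

end CountingCodes

section SystematicCodes

/-- The ternary digits of `b`, the least significant one first, as a vector over `𝔽₃`. -/
def digitVector (k b : ℕ) : Fin k → ZMod 3 :=
  fun i => ((b / 3 ^ (i : ℕ) % 3 : ℕ) : ZMod 3)

theorem mod_pow_succ_eq_iff {p m b c : ℕ} : c % p ^ (m + 1) = b % p ^ (m + 1) ↔
    c % p ^ m = b % p ^ m ∧ c / p ^ m % p = b / p ^ m % p := by
  refine ⟨fun h => ⟨?_, ?_⟩, fun h => by rw [Nat.mod_pow_succ, Nat.mod_pow_succ, h.1, h.2]⟩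
  · have := congrArg (· % p ^ m) h
    simpa only [Nat.mod_mod_of_dvd _ (pow_dvd_pow p m.le_succ)] using this
  · have := congrArg (· / p ^ m) h
    simpa only [pow_succ, Nat.mod_mul_right_div_self] using this

theorem digitVector_eq_below_iff {k m b c : ℕ} (hm : m ≤ k) :
    (∀ i : Fin k, (i : ℕ) < m → digitVector k c i = digitVector k b i) ↔
      c % 3 ^ m = b % 3 ^ m := by
  induction m with
  | zero => simp [Nat.mod_one]
  | succ m ih =>
    have hdigit : digitVector k c ⟨m, hm⟩ = digitVector k b ⟨m, hm⟩ ↔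
        c / 3 ^ m % 3 = b / 3 ^ m % 3 := by
      rw [digitVector, digitVector, ZMod.natCast_eq_natCast_iff', Nat.mod_mod, Nat.mod_mod]
    rw [mod_pow_succ_eq_iff, ← ih (Nat.le_of_succ_le hm), ← hdigit]
    refine ⟨fun h => ⟨fun i hi => h i (hi.trans m.lt_succ_self), h _ m.lt_succ_self⟩, ?_⟩
    rintro ⟨hlt, heq⟩ i hi
    rcases Nat.lt_succ_iff_lt_or_eq.1 hi with hi | hi
    · exact hlt i hi
    · rwa [show i = ⟨m, hm⟩ from Fin.ext hi]

theorem digitVector_bijective (k : ℕ) :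
    Function.Bijective fun b : Fin (3 ^ k) => digitVector k b := by
  refine (Fintype.bijective_iff_injective_and_card _).2 ⟨fun b c h => Fin.ext ?_, by simp⟩
  have := (digitVector_eq_below_iff le_rfl).1 fun i _ => congrFun h i
  rwa [Nat.mod_eq_of_lt b.2, Nat.mod_eq_of_lt c.2] at this

/-- The numbers of the columns of the generator matrix numbered `a`, which starts with the identity
matrix. The digits of `a` in base `243` are the numbers of the other columns. -/
def column (a j : ℕ) : ℕ :=
  if j < 5 then 3 ^ j else a / 243 ^ (j - 5) % 243

/-- The entry `j` of the word numbered `b` in the code with the generator matrix numbered `a`. -/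
def entry (a b j : ℕ) : ZMod 3 :=
  digitVector 5 b ⬝ᵥ digitVector 5 (column a j)

/-- The words of the code with the generator matrix numbered `a`, for `b < 243`. -/
def codeword (a b : ℕ) : Fin 10 → ZMod 3 :=
  fun j => entry a b j

/-- The code with the generator matrix numbered `a`. -/
def codeOf (a : ℕ) : Submodule (ZMod 3) (Fin 10 → ZMod 3) :=
  LinearMap.range
    (Matrix.of fun i (j : Fin 10) => digitVector 5 (column a j) i).vecMulLinear

theorem digitVector_column {a : ℕ} {i : Fin 5} : digitVector 5 (column a i) = Pi.single i 1 := by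
  rw [column, if_pos i.2]
  revert i
  decide

theorem codeword_castLE (a b : ℕ) (i : Fin 5) :
    codeword a b (i.castLE (by norm_num)) = digitVector 5 b i := by
  rw [codeword, entry, Fin.val_castLE, digitVector_column, dotProduct_single_one]

theorem codeword_injective (a : ℕ) : Function.Injective fun b : Fin 243 => codeword a b :=
  fun b c h => (digitVector_bijective 5).1 <| funext fun i => by
    simpa only [codeword_castLE] using congrFun h (i.castLE (by norm_num))

theorem range_codeword (a : ℕ) : Set.range (fun b : Fin 243 => codeword a b) = codeOf a := by
  rw [codeOf, LinearMap.coe_range]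
  exact (digitVector_bijective 5).2.range_comp
    (Matrix.of fun i (j : Fin 10) => digitVector 5 (column a j) i).vecMulLinear

theorem codeword_mem (a b : ℕ) : codeword a b ∈ codeOf a :=
  ⟨digitVector 5 b, rfl⟩

theorem finrank_codeOf (a : ℕ) : Module.finrank (ZMod 3) (codeOf a) = 5 := by
  have hcard : Nat.card (codeOf a) = 243 := by
    rw [← SetLike.coe_sort_coe, ← range_codeword,
      Nat.card_range_of_injective (codeword_injective a), Nat.card_fin]
  rw [Module.natCard_eq_pow_finrank (K := ZMod 3), Nat.card_zmod] at hcard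
  exact Nat.pow_right_injective (a := 3) (by norm_num) (hcard : 3 ^ _ = 3 ^ 5)

theorem codeword_eq_below_iff {a b c i : ℕ} :
    (∀ k : Fin 10, (k : ℕ) < i → codeword a c k = codeword a b k) ↔
      c % 3 ^ min i 5 = b % 3 ^ min i 5 := by
  rw [← digitVector_eq_below_iff (min_le_right i 5)]
  constructor
  · intro h k hk
    simpa only [codeword_castLE] using h (k.castLE (by norm_num)) (hk.trans_le (min_le_left i 5))
  · intro h k hk
    rcases lt_or_ge (k : ℕ) 5 with hk5 | hk5
    · have := h ⟨k, hk5⟩ (lt_min hk hk5)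
      rwa [← codeword_castLE a, ← codeword_castLE a] at this
    · have : digitVector 5 c = digitVector 5 b := funext fun l => h l (by omega)
      rw [codeword, codeword, entry, entry, this]

theorem enumerator_codeOf (a : ℕ) (p : (Fin 10 → ZMod 3) → Prop) [DecidablePred p] :
    enumerator {c | c ∈ codeOf a ∧ p c} =
      ∑ b ∈ Finset.range 243, if p (codeword a b) then 2 ^ hammingNorm (codeword a b) else 0 := by
  classical
  have hfilter : Finset.univ.filter (· ∈ codeOf a) =
      Finset.univ.map ⟨fun b : Fin 243 => codeword a b, codeword_injective a⟩ := by
    ext c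
    rw [Finset.mem_filter_univ, ← SetLike.mem_coe, ← range_codeword]
    simp
  simp only [enumerator, Set.mem_ofPred_eq]
  rw [← Finset.filter_filter, hfilter, Finset.sum_filter, Finset.sum_map, Finset.sum_range]
  rfl

end SystematicCodes

section Lanes

/-- The largest number that fits into a lane of 32 bits. -/
def fullLane : ℕ :=
  2 ^ 32 - 1

/-- The number whose `i`-th lane of 32 bits, for `i < n`, is `f i`. -/
def lanes (f : ℕ → ℕ) (n : ℕ) : ℕ :=
  ∑ i ∈ Finset.range n, f i * 2 ^ (32 * i)

variable {f g : ℕ → ℕ} {n : ℕ}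

theorem lanes_congr (h : ∀ i < n, f i = g i) : lanes f n = lanes g n :=
  Finset.sum_congr rfl fun i hi => by rw [h i (Finset.mem_range.1 hi)]

theorem lanes_add (f g : ℕ → ℕ) (n : ℕ) :
    lanes f n + lanes g n = lanes (fun i => f i + g i) n := by
  simp only [lanes, add_mul, Finset.sum_add_distrib]

theorem lanes_mul (f : ℕ → ℕ) (n c : ℕ) : lanes f n * c = lanes (fun i => f i * c) n := by
  simp only [lanes, Finset.sum_mul, mul_right_comm]

theorem lanes_lt (hf : ∀ i < n, f i < 2 ^ 32) : lanes f n < 2 ^ (32 * n) := by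
  induction n with
  | zero => simp [lanes]
  | succ n ih =>
    rw [lanes, Finset.sum_range_succ, ← lanes]
    calc lanes f n + f n * 2 ^ (32 * n) < 2 ^ (32 * n) + f n * 2 ^ (32 * n) :=
          Nat.add_lt_add_right (ih fun i hi => hf i (hi.trans n.lt_succ_self)) _
      _ = (f n + 1) * 2 ^ (32 * n) := by ring
      _ ≤ 2 ^ 32 * 2 ^ (32 * n) := Nat.mul_le_mul_right _ (hf n n.lt_succ_self)
      _ = 2 ^ (32 * (n + 1)) := by ring

theorem testBit_lanes (hf : ∀ i < n, f i < 2 ^ 32) (k : ℕ) :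
    (lanes f n).testBit k = (decide (k / 32 < n) && (f (k / 32)).testBit (k % 32)) := by
  induction n with
  | zero => simp [lanes]
  | succ n ih =>
    have hf' : ∀ i < n, f i < 2 ^ 32 := fun i hi => hf i (hi.trans n.lt_succ_self)
    rw [lanes, Finset.sum_range_succ, ← lanes, add_comm, mul_comm,
      Nat.testBit_two_pow_mul_add _ (lanes_lt hf'), ih hf']
    split_ifs with hk
    · simp [show k / 32 < n by omega, show k / 32 < n + 1 by omega]
    · by_cases hn : k / 32 = n
      · simp [hn, show k - 32 * n = k % 32 by omega]
      · have hlt : f n < 2 ^ (k - 32 * n) :=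
          (hf n n.lt_succ_self).trans_le (Nat.pow_le_pow_right two_pos (by omega))
        simp [Nat.testBit_lt_two_pow hlt, show ¬ k / 32 < n + 1 by omega]

theorem lanes_inj (hf : ∀ i < n, f i < 2 ^ 32) (hg : ∀ i < n, g i < 2 ^ 32) :
    lanes f n = lanes g n ↔ ∀ i < n, f i = g i := by
  refine ⟨fun h i hi => Nat.eq_of_testBit_eq fun k => ?_, lanes_congr⟩
  rcases lt_or_ge k 32 with hk | hk
  · have := congrArg (Nat.testBit · (32 * i + k)) h
    simpa [testBit_lanes hf, testBit_lanes hg, show (32 * i + k) / 32 = i by omega, hi,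
      Nat.mul_add_mod, Nat.mod_eq_of_lt hk] using this
  · have hpow : 2 ^ 32 ≤ 2 ^ k := Nat.pow_le_pow_right two_pos hk
    rw [Nat.testBit_lt_two_pow ((hf i hi).trans_le hpow),
      Nat.testBit_lt_two_pow ((hg i hi).trans_le hpow)]

theorem lanes_land (hf : ∀ i < n, f i < 2 ^ 32) (hg : ∀ i < n, g i < 2 ^ 32) :
    lanes f n &&& lanes g n = lanes (fun i => f i &&& g i) n := by
  refine Nat.eq_of_testBit_eq fun k => ?_
  rw [Nat.testBit_land, testBit_lanes hf, testBit_lanes hg,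
    testBit_lanes fun i hi => Nat.and_lt_two_pow _ (hg i hi), Nat.testBit_land]
  cases decide (k / 32 < n) <;> rfl

theorem lanes_land_ite_fullLane (hf : ∀ i < n, f i < 2 ^ 32) (p : ℕ → Prop) [DecidablePred p] :
    lanes f n &&& lanes (fun i => if p i then fullLane else 0) n =
      lanes (fun i => if p i then f i else 0) n := by
  rw [lanes_land hf fun i _ => by split_ifs <;> simp [fullLane]]
  refine lanes_congr fun i hi => ?_
  split_ifs
  · rw [fullLane, Nat.and_two_pow_sub_one_eq_mod, Nat.mod_eq_of_lt (hf i hi)]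
  · exact Nat.and_zero _

theorem lanes_shiftRight_land {s : ℕ} (hs : s < 32) (hf : ∀ i < n, f i < 2 ^ 32) :
    lanes f n >>> s &&& lanes (fun _ => 1) n = lanes (fun i => f i / 2 ^ s % 2) n := by
  refine Nat.eq_of_testBit_eq fun k => ?_
  have hone : (1 : ℕ).testBit (k % 32) = decide (k % 32 < 1) := Nat.testBit_two_pow_sub_one 1 _
  have hbit : (f (k / 32) / 2 ^ s % 2).testBit (k % 32) =
      (decide (k % 32 < 1) && (f (k / 32)).testBit (k % 32 + s)) := by
    rw [← Nat.testBit_div_two_pow, ← Nat.testBit_mod_two_pow, pow_one]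
  rw [Nat.testBit_land, Nat.testBit_shiftRight, testBit_lanes hf, testBit_lanes (by simp),
    testBit_lanes fun i _ => (Nat.mod_lt _ two_pos).trans (by norm_num), hone, hbit]
  by_cases hk : k % 32 < 1
  · rw [show (s + k) / 32 = k / 32 by omega, show (s + k) % 32 = k % 32 + s by omega]
    cases decide (k / 32 < n) <;> simp [hk]
  · simp [hk]

theorem lanes_mod (f : ℕ → ℕ) (n m : ℕ) :
    lanes f n % (2 ^ (32 * m) - 1) =
      (∑ i ∈ Finset.range n, f i * 2 ^ (32 * (i % m))) % (2 ^ (32 * m) - 1) := by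
  have hone : 2 ^ (32 * m) ≡ 1 [MOD 2 ^ (32 * m) - 1] :=
    ((Nat.modEq_iff_dvd' Nat.one_le_two_pow).2 dvd_rfl).symm
  refine Nat.ModEq.sum fun i _ => Nat.ModEq.mul_left _ ?_
  calc 2 ^ (32 * i) = 2 ^ (32 * (i % m)) * (2 ^ (32 * m)) ^ (i / m) := by
        rw [← pow_mul, ← pow_add, mul_assoc, ← mul_add, Nat.mod_add_div]
    _ ≡ 2 ^ (32 * (i % m)) * 1 ^ (i / m) [MOD 2 ^ (32 * m) - 1] := (hone.pow _).mul_left _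
    _ = 2 ^ (32 * (i % m)) := by rw [one_pow, mul_one]

end Lanes

section Evaluation

/-- `∑ i ∈ Finset.range n, f i`. The kernel evaluates this recursion much faster than the sum over
a `Finset`. -/
def sumBelow (f : ℕ → ℕ) : ℕ → ℕ
  | 0 => 0
  | n + 1 => sumBelow f n + f n

theorem sumBelow_eq_sum_range (f : ℕ → ℕ) (n : ℕ) :
    sumBelow f n = ∑ i ∈ Finset.range n, f i := by
  induction n with
  | zero => rfl
  | succ n ih => rw [sumBelow, ih, Finset.sum_range_succ]

/-- The number with `1` in each of `243` lanes. -/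
def ones : ℕ :=
  lanes (fun _ => 1) 243

/-- The `k`-th ternary digits of the lane numbers, times `43`. -/
def digitLanes (k : ℕ) : ℕ :=
  lanes (fun b => 43 * (b / 3 ^ k % 3)) 243

/-- In lane `b`, the dot product of the ternary digits of `b` and `v`, computed in `ℕ` and
multiplied by `43`. -/
def valueLanes (v : ℕ) : ℕ :=
  digitLanes 0 * (v % 3) + digitLanes 1 * (v / 3 % 3) + digitLanes 2 * (v / 9 % 3) +
    digitLanes 3 * (v / 27 % 3) + digitLanes 4 * (v / 81 % 3)

/-- The bits at position `s` of the lanes of `x`, each one copied to its whole lane. -/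
def spreadBit (s x : ℕ) : ℕ :=
  (x >>> s &&& ones) * fullLane

/-- The mask of the codewords with entry `j` equal to `1`. -/
def mask (a j : ℕ) : ℕ :=
  spreadBit 5 (valueLanes (column a j))

/-- The mask of the codewords with entry `j` equal to `-1`. -/
def negMask (a j : ℕ) : ℕ :=
  spreadBit 6 (valueLanes (column a j))

theorem valueLanes_eq (v : ℕ) : valueLanes v =
    lanes (fun b => 43 * ∑ k : Fin 5, b / 3 ^ (k : ℕ) % 3 * (v / 3 ^ (k : ℕ) % 3)) 243 := by
  simp only [valueLanes, digitLanes, lanes_mul, lanes_add]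
  refine lanes_congr fun b _ => ?_
  simp only [Fin.sum_univ_five, Fin.val_zero, Fin.val_one, Fin.val_two,
    show ((3 : Fin 5) : ℕ) = 3 from rfl, show ((4 : Fin 5) : ℕ) = 4 from rfl]
  norm_num
  ring

theorem sum_digit_mul_digit_lt (b v : ℕ) :
    ∑ k : Fin 5, b / 3 ^ (k : ℕ) % 3 * (v / 3 ^ (k : ℕ) % 3) < 21 :=
  calc ∑ k : Fin 5, b / 3 ^ (k : ℕ) % 3 * (v / 3 ^ (k : ℕ) % 3) ≤ ∑ _k : Fin 5, 2 * 2 :=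
        Finset.sum_le_sum fun k _ => Nat.mul_le_mul
          (Nat.le_of_lt_succ (Nat.mod_lt _ three_pos)) (Nat.le_of_lt_succ (Nat.mod_lt _ three_pos))
    _ < 21 := by decide

theorem natCast_sum_digit_mul_digit (b v : ℕ) :
    ((∑ k : Fin 5, b / 3 ^ (k : ℕ) % 3 * (v / 3 ^ (k : ℕ) % 3) : ℕ) : ZMod 3) =
      digitVector 5 b ⬝ᵥ digitVector 5 v := by
  simp only [dotProduct, digitVector, Nat.cast_sum, Nat.cast_mul]

theorem spreadBit_lanes {f : ℕ → ℕ} {s : ℕ} (hs : s < 32) (hf : ∀ b < 243, f b < 2 ^ 32) :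
    spreadBit s (lanes f 243) = lanes (fun b => f b / 2 ^ s % 2 * fullLane) 243 := by
  rw [spreadBit, ones, lanes_shiftRight_land hs hf, lanes_mul]

-- Since `43 / 128` is close to `1 / 3`, these bits of `43 * t` are those of `t / 3`.
theorem bits_forty_three_mul : ∀ t < 21,
    43 * t / 2 ^ 5 % 2 = (if ((t : ℕ) : ZMod 3) = 1 then 1 else 0) ∧
      43 * t / 2 ^ 6 % 2 = if ((t : ℕ) : ZMod 3) = -1 then 1 else 0 := by
  decide

theorem mask_eq (a j : ℕ) :
    mask a j = lanes (fun b => if entry a b j = 1 then fullLane else 0) 243 := by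
  have hlt := fun b => sum_digit_mul_digit_lt b (column a j)
  rw [mask, valueLanes_eq, spreadBit_lanes (by norm_num) fun b _ => by have := hlt b; omega]
  refine lanes_congr fun b _ => ?_
  rw [(bits_forty_three_mul _ (hlt b)).1, natCast_sum_digit_mul_digit, ite_mul, one_mul, zero_mul,
    entry]

theorem negMask_eq (a j : ℕ) :
    negMask a j = lanes (fun b => if entry a b j = -1 then fullLane else 0) 243 := by
  have hlt := fun b => sum_digit_mul_digit_lt b (column a j)
  rw [negMask, valueLanes_eq, spreadBit_lanes (by norm_num) fun b _ => by have := hlt b; omega]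
  refine lanes_congr fun b _ => ?_
  rw [(bits_forty_three_mul _ (hlt b)).2, natCast_sum_digit_mul_digit, ite_mul, one_mul, zero_mul,
    entry]

/-- In lane `b`, the number `2 ^ w` for the number `w` of nonzero entries before entry `j` of the
codeword `b`. -/
def weightLanes (a : ℕ) : ℕ → ℕ
  | 0 => ones
  | j + 1 => weightLanes a j + (weightLanes a j &&& mask a j) + (weightLanes a j &&& negMask a j)

theorem weightLanes_eq {a j : ℕ} (hj : j < 32) : weightLanes a j =
    lanes (fun b => ∏ k ∈ Finset.range j, if entry a b k = 0 then 1 else 2) 243 := by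
  induction j with
  | zero => simp only [weightLanes, ones, Finset.prod_range_zero]
  | succ j ih =>
    have hlt : ∀ b < 243, ∏ k ∈ Finset.range j, (if entry a b k = 0 then 1 else 2) < 2 ^ 32 := by
      refine fun b _ => lt_of_le_of_lt ?_ (Nat.pow_lt_pow_right one_lt_two (Nat.lt_of_succ_lt hj))
      simpa using Finset.prod_le_pow_card (Finset.range j) _ 2 fun k _ => by
        split_ifs <;> norm_num
    rw [weightLanes, ih (Nat.lt_of_succ_lt hj), mask_eq, negMask_eq,
      lanes_land_ite_fullLane hlt, lanes_land_ite_fullLane hlt, lanes_add, lanes_add]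
    refine lanes_congr fun b _ => ?_
    have hsplit : ∀ x : ZMod 3, (if x = 0 then 1 else 2) =
        1 + (if x = 1 then 1 else 0) + if x = -1 then 1 else 0 := by decide
    rw [Finset.prod_range_succ, hsplit (entry a b j), mul_add, mul_add, mul_ite, mul_ite, mul_one,
      mul_zero]

theorem weightLanes_ten (a : ℕ) :
    weightLanes a 10 = lanes (fun b => 2 ^ hammingNorm (codeword a b)) 243 := by
  rw [weightLanes_eq (by norm_num)]
  refine lanes_congr fun b _ => ?_
  rw [Finset.prod_range, hammingNorm, ← Finset.prod_const, Finset.prod_filter]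
  exact Finset.prod_congr rfl fun k _ => by by_cases h : entry a b k = 0 <;> simp [codeword, h]

theorem two_pow_hammingNorm_le (c : Fin 10 → ZMod 3) : 2 ^ hammingNorm c ≤ 2 ^ 10 :=
  Nat.pow_le_pow_right two_pos (hammingNorm_le_card_fintype.trans_eq (Fintype.card_fin 10))

/-- The mask of the codewords with signed coordinate `u` equal to `1`. -/
def maskLanes (a : ℕ) (u : Fin 10 → ZMod 3) : ℕ :=
  lanes (fun b => if u ⬝ᵥ codeword a b = 1 then fullLane else 0) 243

/-- In lane `b`, the number `2 ^ w` for the weight `w` of the codeword `b`, if this codeword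
satisfies `p`. -/
def enumeratorLanes (a : ℕ) (p : (Fin 10 → ZMod 3) → Prop) [DecidablePred p] : ℕ :=
  lanes (fun b => if p (codeword a b) then 2 ^ hammingNorm (codeword a b) else 0) 243

theorem mask_eq_maskLanes (a : ℕ) (j : Fin 10) : mask a j = maskLanes a (Pi.single j 1) := by
  simp only [mask_eq, maskLanes, single_one_dotProduct, codeword]

theorem negMask_eq_maskLanes (a : ℕ) (j : Fin 10) :
    negMask a j = maskLanes a (-Pi.single j 1) := by
  simp only [negMask_eq, maskLanes, neg_dotProduct, single_one_dotProduct, codeword,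
    neg_eq_iff_eq_neg]

variable (a : ℕ) (u v : Fin 10 → ZMod 3)

theorem weightLanes_land_maskLanes :
    weightLanes a 10 &&& maskLanes a u = enumeratorLanes a (u ⬝ᵥ · = 1) := by
  rw [weightLanes_ten, maskLanes, lanes_land_ite_fullLane]
  · rfl
  · exact fun b _ => (two_pow_hammingNorm_le _).trans_lt (by norm_num)

theorem enumeratorLanes_land_maskLanes :
    enumeratorLanes a (u ⬝ᵥ · = 1) &&& maskLanes a v =
      enumeratorLanes a fun c => u ⬝ᵥ c = 1 ∧ v ⬝ᵥ c = 1 := by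
  rw [enumeratorLanes, maskLanes, lanes_land_ite_fullLane]
  · simp only [enumeratorLanes, ← ite_and, and_comm]
  · refine fun b _ => lt_of_le_of_lt ?_ (b := 2 ^ 10) (by norm_num)
    split_ifs
    exacts [two_pow_hammingNorm_le _, Nat.zero_le _]

theorem enumeratorLanes_mod (p : (Fin 10 → ZMod 3) → Prop) [DecidablePred p] :
    enumeratorLanes a p % fullLane = enumerator {c | c ∈ codeOf a ∧ p c} := by
  have hle : enumerator {c | c ∈ codeOf a ∧ p c} ≤ 243 * 2 ^ 10 := by
    rw [enumerator_codeOf]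
    refine (Finset.sum_le_card_nsmul _ _ (2 ^ 10) fun b _ => ?_).trans (by simp)
    split_ifs
    exacts [two_pow_hammingNorm_le _, Nat.zero_le _]
  have hmod := lanes_mod
    (fun b => if p (codeword a b) then 2 ^ hammingNorm (codeword a b) else 0) 243 1
  simp only [mul_one, Nat.mod_one, mul_zero, pow_zero, ← enumerator_codeOf] at hmod
  rw [enumeratorLanes, fullLane, hmod, Nat.mod_eq_of_lt (hle.trans_lt (by norm_num))]

theorem enumeratorLanes_land_maskLanes_mod :
    (enumeratorLanes a (u ⬝ᵥ · = 1) &&& maskLanes a v) % fullLane =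
      pairEnumerator (codeOf a) u v := by
  rw [enumeratorLanes_land_maskLanes, enumeratorLanes_mod, pairEnumerator]

theorem enumeratorLanes_mod_two_pow_sub_one {i m : ℕ} (hm : m = 3 ^ min i 5) :
    enumeratorLanes a (u ⬝ᵥ · = 1) % (2 ^ (32 * m) - 1) =
      (∑ r ∈ Finset.range m, prefixEnumerator (codeOf a) i (codeword a r) u * 2 ^ (32 * r)) %
        (2 ^ (32 * m) - 1) := by
  have hpos : 0 < m := hm ▸ pow_pos three_pos _
  rw [enumeratorLanes, lanes_mod, ← Finset.sum_fiberwise_of_maps_to (g := (· % m))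
    fun b _ => Finset.mem_range.2 (Nat.mod_lt b hpos)]
  refine congrArg (· % _) (Finset.sum_congr rfl fun r hr => ?_)
  rw [prefixEnumerator, enumerator_codeOf, Finset.sum_mul, Finset.sum_filter]
  refine Finset.sum_congr rfl fun b _ => ?_
  simp only [codeword_eq_below_iff, ← hm, Nat.mod_eq_of_lt (Finset.mem_range.1 hr)]
  split_ifs <;> simp_all

end Evaluation

section Invariants

theorem hammingNorm_eq_one_iff {n : ℕ} {v : Fin n → ZMod 3} :
    hammingNorm v = 1 ↔ ∃ (j : Fin n) (ε : (ZMod 3)ˣ), Pi.single j (ε : ZMod 3) = v := by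
  constructor
  · intro hv
    obtain ⟨j, hj⟩ := Finset.card_eq_one.1 hv
    have hsupport : ∀ k, v k ≠ 0 ↔ k = j := by simpa [Finset.ext_iff] using hj
    refine ⟨j, Units.mk0 _ ((hsupport j).2 rfl), funext fun k => ?_⟩
    rcases eq_or_ne k j with rfl | hk
    · simp
    · rw [Pi.single_eq_of_ne hk, not_not.1 (mt (hsupport k).1 hk)]
  · rintro ⟨j, ε, rfl⟩
    exact hammingNorm_single j ε.ne_zero

theorem sum_hammingNorm_eq_one {n : ℕ} (f : (Fin n → ZMod 3) → ℕ) :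
    ∑ v with hammingNorm v = 1, f v = ∑ j, (f (Pi.single j 1) + f (-Pi.single j 1)) := by
  classical
  have hunits : (Finset.univ : Finset (ZMod 3)ˣ) = {1, -1} := by decide
  have himage : ({v | hammingNorm v = 1} : Finset (Fin n → ZMod 3)) =
      Finset.univ.image fun x : Fin n × (ZMod 3)ˣ => Pi.single x.1 (x.2 : ZMod 3) := by
    ext v
    simp [hammingNorm_eq_one_iff]
  rw [himage, Finset.sum_image, Fintype.sum_prod_type]
  · refine Finset.sum_congr rfl fun j _ => ?_
    rw [hunits, Finset.sum_pair (by decide), Units.val_neg, Units.val_one, Pi.single_neg]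
  · rintro ⟨j, ε⟩ - ⟨k, δ⟩ - h
    obtain rfl : j = k := by
      by_contra hjk
      simpa [hjk] using congrFun h j
    exact congrArg (j, ·) (Units.ext (Pi.single_injective j h))

/-- The words of the code `a` with coordinate `j` equal to `1`, weighted as in `enumeratorLanes`. -/
def coordLanes (a j : ℕ) : ℕ :=
  weightLanes a 10 &&& mask a j

/-- The analogue of `coordLanes` for coordinate `j` equal to `-1`. -/
def negCoordLanes (a j : ℕ) : ℕ :=
  weightLanes a 10 &&& negMask a j

/-- The moment of coordinate `i` of the code `a`, for evaluation by the kernel. -/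
def coordMoment (a i : ℕ) : ℕ :=
  sumBelow (fun j => ((coordLanes a i &&& mask a j) % fullLane) ^ 3 +
    ((coordLanes a i &&& negMask a j) % fullLane) ^ 3) 10

/-- The sum of the moments of the coordinates of the code `a`. -/
def coordMomentSum (a : ℕ) : ℕ :=
  sumBelow (coordMoment a) 10

/-- A bound for the number of candidates for coordinate `i` of the code `a`. The prefix enumerators
are compared through `coordLanes` modulo `q`. -/
def candidateBound (a i q : ℕ) : ℕ :=
  sumBelow (fun j => if i ≤ j ∧ coordMoment a j = coordMoment a i then
    (if coordLanes a j % q = coordLanes a i % q then 1 else 0) +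
      (if negCoordLanes a j % q = coordLanes a i % q then 1 else 0) else 0) 10

/-- A bound for the order of the stabilizer of the code `a`. -/
def stabilizerBound (a : ℕ) : ℕ :=
  ∏ i ∈ Finset.range 10, candidateBound a i (2 ^ (32 * 3 ^ min i 5) - 1)

/-- A test for `HasMinWeightGE (codeOf a) t`, for evaluation by the kernel: no lane of
`weightLanes a 10` but that of the zero word has a bit below position `t`. -/
def MinWeightGETest (a t : ℕ) : Prop :=
  weightLanes a 10 &&& ones * (2 ^ t - 1) = 1

instance (a t : ℕ) : Decidable (MinWeightGETest a t) :=
  inferInstanceAs (Decidable (_ = _))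

variable (a : ℕ)

theorem coordLanes_eq_enumeratorLanes (j : Fin 10) :
    coordLanes a j = enumeratorLanes a (Pi.single j 1 ⬝ᵥ · = 1) := by
  rw [coordLanes, mask_eq_maskLanes, weightLanes_land_maskLanes]

theorem negCoordLanes_eq_enumeratorLanes (j : Fin 10) :
    negCoordLanes a j = enumeratorLanes a (-Pi.single j 1 ⬝ᵥ · = 1) := by
  rw [negCoordLanes, negMask_eq_maskLanes, weightLanes_land_maskLanes]

theorem coordMoment_eq_moment (i : Fin 10) :
    coordMoment a i = moment (codeOf a) (Pi.single i 1) := by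
  rw [coordMoment, sumBelow_eq_sum_range, Finset.sum_range, moment, sum_hammingNorm_eq_one]
  simp only [coordLanes_eq_enumeratorLanes, mask_eq_maskLanes, negMask_eq_maskLanes,
    enumeratorLanes_land_maskLanes_mod]

theorem momentSum_codeOf : momentSum (codeOf a) = 2 * coordMomentSum a := by
  simp only [coordMomentSum, sumBelow_eq_sum_range, Finset.sum_range, coordMoment_eq_moment,
    momentSum, sum_hammingNorm_eq_one, moment_neg, ← two_mul, Finset.mul_sum]

section Candidates

variable {a} {i j : Fin 10} {u : Fin 10 → ZMod 3}

theorem enumeratorLanes_mod_eq_of_mem_candidates (hu : u ∈ candidates (codeOf a) i) :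
    enumeratorLanes a (u ⬝ᵥ · = 1) % (2 ^ (32 * 3 ^ min (i : ℕ) 5) - 1) =
      coordLanes a i % (2 ^ (32 * 3 ^ min (i : ℕ) 5) - 1) := by
  obtain ⟨-, -, -, hprefix⟩ := mem_candidates_iff.1 hu
  rw [coordLanes_eq_enumeratorLanes, enumeratorLanes_mod_two_pow_sub_one a u rfl,
    enumeratorLanes_mod_two_pow_sub_one a (Pi.single i 1) rfl]
  simp only [hprefix _ (codeword_mem a _)]

theorem le_and_coordMoment_eq_of_mem_candidates (hu : u ∈ candidates (codeOf a) i)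
    (huj : u = Pi.single j 1 ∨ u = -Pi.single j 1) :
    (i : ℕ) ≤ j ∧ coordMoment a j = coordMoment a i := by
  obtain ⟨-, hzero, hmoment, -⟩ := mem_candidates_iff.1 hu
  rw [coordMoment_eq_moment, coordMoment_eq_moment, ← hmoment]
  constructor
  · by_contra! hlt
    have := hzero j hlt
    rcases huj with rfl | rfl <;> simp at this
  · rcases huj with rfl | rfl
    · rfl
    · rw [moment_neg]

end Candidates

theorem card_candidates_codeOf_le (i : Fin 10) :
    (candidates (codeOf a) i).card ≤
      candidateBound a i (2 ^ (32 * 3 ^ min (i : ℕ) 5) - 1) := by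
  classical
  have hsum : (candidates (codeOf a) i).card =
      ∑ v with hammingNorm v = 1, if v ∈ candidates (codeOf a) i then 1 else 0 := by
    rw [Finset.sum_boole, Nat.cast_id, Finset.filter_filter]
    refine congrArg _ (Finset.ext fun v => ?_)
    rw [Finset.mem_filter_univ]
    exact ⟨fun hv => ⟨(mem_candidates_iff.1 hv).1, hv⟩, And.right⟩
  have hite {p q : Prop} [Decidable p] [Decidable q] (h : p → q) :
      (if p then 1 else 0) ≤ if q then 1 else 0 := by
    by_cases hp : p <;> simp [hp, h]
  rw [hsum, sum_hammingNorm_eq_one, candidateBound, sumBelow_eq_sum_range, Finset.sum_range]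
  refine Finset.sum_le_sum fun j _ => ?_
  by_cases hj : (i : ℕ) ≤ j ∧ coordMoment a j = coordMoment a i
  · rw [if_pos hj, coordLanes_eq_enumeratorLanes a j, negCoordLanes_eq_enumeratorLanes a j]
    exact add_le_add (hite enumeratorLanes_mod_eq_of_mem_candidates)
      (hite enumeratorLanes_mod_eq_of_mem_candidates)
  · rw [if_neg hj, if_neg fun h => hj (le_and_coordMoment_eq_of_mem_candidates h (.inl rfl)),
      if_neg fun h => hj (le_and_coordMoment_eq_of_mem_candidates h (.inr rfl))]

theorem card_stabilizer_codeOf_le :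
    Nat.card (MulAction.stabilizer (signedPermGroup 10) (codeOf a)) ≤ stabilizerBound a := by
  refine (card_stabilizer_le_prod_card_candidates _).trans ?_
  rw [stabilizerBound, Finset.prod_range]
  exact Finset.prod_le_prod' fun i _ => card_candidates_codeOf_le a i

theorem codeword_zero : codeword a 0 = 0 := by
  have hzero : digitVector 5 0 = 0 := funext fun i => by simp [digitVector]
  funext j
  rw [codeword, entry, hzero, zero_dotProduct, Pi.zero_apply]

theorem hasMinWeightGE_codeOf_iff_forall_lt {t : ℕ} : HasMinWeightGE (codeOf a) t ↔
    ∀ b < 243, b ≠ 0 → t ≤ hammingNorm (codeword a b) := by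
  have hne : ∀ b < 243, b ≠ 0 → codeword a b ≠ 0 := fun b hb hb0 h0 => hb0 <|
    Fin.mk.inj_iff.1 <| codeword_injective a (a₁ := ⟨b, hb⟩) (a₂ := ⟨0, by norm_num⟩) <|
      h0.trans (codeword_zero a).symm
  constructor
  · exact fun h b hb hb0 => h _ (codeword_mem a b) (hne b hb hb0)
  · intro h c hc hc0
    rw [← SetLike.mem_coe, ← range_codeword] at hc
    obtain ⟨b, rfl⟩ := hc
    exact h b b.2 fun hb => hc0 (by simp only [hb, codeword_zero])

theorem two_pow_land_two_pow_sub_one (w t : ℕ) :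
    2 ^ w &&& (2 ^ t - 1) = if w < t then 2 ^ w else 0 := by
  rw [Nat.and_two_pow_sub_one_eq_mod]
  split_ifs with hwt
  · exact Nat.mod_eq_of_lt (Nat.pow_lt_pow_right one_lt_two hwt)
  · exact Nat.mod_eq_zero_of_dvd (pow_dvd_pow 2 (not_lt.1 hwt))

theorem hasMinWeightGE_codeOf_iff {t : ℕ} (h0 : 0 < t) (ht : t ≤ 32) :
    HasMinWeightGE (codeOf a) t ↔ MinWeightGETest a t := by
  have hlt : ∀ b, 2 ^ hammingNorm (codeword a b) < 2 ^ 32 := fun b =>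
    (two_pow_hammingNorm_le _).trans_lt (by norm_num)
  have hpow : 1 * (2 ^ t - 1) < 2 ^ 32 := by
    have := Nat.pow_le_pow_right two_pos ht
    omega
  have hone : 1 = lanes (fun b => if b = 0 then 1 else 0) 243 := by
    simp [lanes]
  rw [MinWeightGETest, weightLanes_ten, ones, lanes_mul,
    lanes_land (fun b _ => hlt b) fun _ _ => hpow]
  conv_rhs => rhs; rw [hone]
  rw [lanes_inj (fun b _ => Nat.and_lt_two_pow _ hpow) fun b _ => by split_ifs <;> norm_num,
    hasMinWeightGE_codeOf_iff_forall_lt]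
  refine forall₂_congr fun b hb => ?_
  rw [one_mul, two_pow_land_two_pow_sub_one]
  rcases eq_or_ne b 0 with rfl | hb0
  · simp [codeword_zero, h0]
  · simp [hb0]

end Invariants

section MinWeight

variable {n d : ℕ} {C D : Submodule (ZMod 3) (Fin n → ZMod 3)}

theorem isMinWeight_iff : IsMinWeight C d ↔ HasMinWeightGE C d ∧ ¬ HasMinWeightGE C (d + 1) := by
  have hlb : ∀ t, HasMinWeightGE C t ↔
      t ∈ lowerBounds {w : ℕ | ∃ c ∈ C, c ≠ 0 ∧ hammingNorm c = w} := fun t =>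
    ⟨fun h w ⟨c, hc, hc0, hw⟩ => hw ▸ h c hc hc0, fun h c hc hc0 => h ⟨c, hc, hc0, rfl⟩⟩
  rw [hlb, hlb, IsMinWeight]
  constructor
  · exact fun h => ⟨h.2, fun h' => (h' h.1).not_gt d.lt_succ_self⟩
  · rintro ⟨h, h'⟩
    simp only [lowerBounds, Set.mem_ofPred_eq, not_forall, not_le] at h'
    obtain ⟨w, hw, hwd⟩ := h'
    exact ⟨(h hw).antisymm (Nat.lt_succ_iff.1 hwd) ▸ hw, h⟩

theorem HasMinWeightGE.mono {t : ℕ} (h : HasMinWeightGE C d) (ht : t ≤ d) : HasMinWeightGE C t :=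
  fun c hc hc0 => ht.trans (h c hc hc0)

theorem Equivalent.hasMinWeightGE (h : Equivalent C D) (hC : HasMinWeightGE C d) :
    HasMinWeightGE D d := by
  obtain ⟨g, rfl⟩ := equivalent_iff_exists_smul_eq.1 h
  intro c hc hc0
  obtain ⟨c, rfl⟩ := MulAction.surjective g c
  rw [hammingNorm_smul]
  exact hC c (smul_mem_smul_iff.1 hc) fun h0 => hc0 <| by
    rw [h0]; exact smul_zero g

theorem Equivalent.isMinWeight (h : Equivalent C D) (hC : IsMinWeight C d) : IsMinWeight D d := by
  rw [isMinWeight_iff] at hC ⊢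
  exact ⟨h.hasMinWeightGE hC.1, fun hD => hC.2 (h.symm.hasMinWeightGE hD)⟩

theorem Equivalent.finrank_eq (h : Equivalent C D) :
    Module.finrank (ZMod 3) C = Module.finrank (ZMod 3) D := by
  obtain ⟨g, rfl⟩ := equivalent_iff_exists_smul_eq.1 h
  exact (g.1.submoduleMap C).finrank_eq

theorem smul_mem_codesGE {k : ℕ} (g : signedPermGroup n) (hC : C ∈ codesGE n k d) :
    g • C ∈ codesGE n k d :=
  have h : Equivalent C (g • C) := equivalent_iff_exists_smul_eq.2 ⟨g, rfl⟩
  ⟨h.finrank_eq ▸ hC.1, h.hasMinWeightGE hC.2⟩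

theorem Equivalent.momentSum_eq (h : Equivalent C D) : momentSum C = momentSum D := by
  obtain ⟨g, rfl⟩ := equivalent_iff_exists_smul_eq.1 h
  exact (momentSum_smul g C).symm

theorem natCard_codeClass_eq {k : ℕ} {ι : Type*} (x : ι → Code n k d)
    (hinj : ∀ i j, Equivalent (x i).1 (x j).1 → i = j)
    (hsurj : ∀ C : Code n k d, ∃ i, Equivalent (x i).1 C.1) :
    Nat.card (CodeClass n k d) = Nat.card ι := by
  refine (Nat.card_congr (.ofBijective (fun i => (⟦x i⟧ : CodeClass n k d)) ⟨?_, ?_⟩)).symm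
  · exact fun i j h => hinj i j (Quotient.exact h)
  · rintro ⟨C⟩
    obtain ⟨i, hi⟩ := hsurj C
    exact ⟨i, Quotient.sound hi⟩

end MinWeight

section Certificates

/-- A test for `IsMinWeight (codeOf a) d`. -/
def MinWeightTest (a d : ℕ) : Prop :=
  MinWeightGETest a d ∧ ¬ MinWeightGETest a (d + 1)

instance (a d : ℕ) : Decidable (MinWeightTest a d) :=
  inferInstanceAs (Decidable (_ ∧ _))

theorem isMinWeight_codeOf_iff {a d : ℕ} (h0 : 0 < d) (hd : d < 32) :
    IsMinWeight (codeOf a) d ↔ MinWeightTest a d := by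
  rw [isMinWeight_iff, hasMinWeightGE_codeOf_iff a h0 hd.le,
    hasMinWeightGE_codeOf_iff a d.succ_pos hd, MinWeightTest]

/-- A lower bound for the size of the orbit of the code `a` under the group of signed coordinate
permutations, which has order `3715891200`. -/
def orbitBound (a : ℕ) : ℕ :=
  3715891200 / stabilizerBound a

/-- `l` lists codes of minimum weight at least `3`, with increasing invariants between `lo` and
`hi`, and `mass` is the sum of the bounds for the sizes of their orbits. -/
def Certified (lo hi mass : ℕ) (l : List ℕ) : Prop :=
  (lo :: (l.map coordMomentSum ++ [hi])).IsChain (· < ·) ∧ (∀ a ∈ l, MinWeightGETest a 3) ∧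
    (l.map orbitBound).sum = mass

instance (lo hi mass : ℕ) (l : List ℕ) : Decidable (Certified lo hi mass l) :=
  inferInstanceAs (Decidable (_ ∧ _ ∧ _))

theorem Certified.append {lo mid hi s t : ℕ} {l₁ l₂ : List ℕ} (h₁ : Certified lo mid s l₁)
    (h₂ : Certified mid hi t l₂) : Certified lo hi (s + t) (l₁ ++ l₂) := by
  refine ⟨?_, fun a ha => (List.mem_append.1 ha).elim (h₁.2.1 a) (h₂.2.1 a), ?_⟩
  · have hchain := List.isChain_split (l₁ := lo :: l₁.map coordMomentSum).2 ⟨h₁.1, h₂.1⟩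
    refine hchain.sublist ?_
    simp
  · rw [List.map_append, List.sum_append, h₁.2.2, h₂.2.2]

variable {lo hi mass : ℕ} {l : List ℕ}

theorem Certified.nodup_map (h : Certified lo hi mass l) : (l.map coordMomentSum).Nodup := by
  have hpair := List.isChain_iff_pairwise.1 h.1
  rw [List.pairwise_cons, List.pairwise_append] at hpair
  exact hpair.2.1.imp ne_of_lt

theorem Certified.eq_of_equivalent (h : Certified lo hi mass l) {a b : ℕ} (ha : a ∈ l)
    (hb : b ∈ l) (hab : Equivalent (codeOf a) (codeOf b)) : a = b := by
  refine List.inj_on_of_nodup_map h.nodup_map ha hb ?_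
  have := hab.momentSum_eq
  rw [momentSum_codeOf, momentSum_codeOf] at this
  omega

theorem card_linearEquiv_eq :
    Nat.card ((Fin 5 → ZMod 3) ≃ₗ[ZMod 3] (Fin 5 → ZMod 3)) = 475566474240 := by
  rw [Nat.card_congr ((LinearMap.GeneralLinearGroup.generalLinearEquiv _ _).symm.trans
    Matrix.GeneralLinearGroup.toLin.symm).toEquiv, Matrix.card_GL_field, ZMod.card]
  decide

theorem ncard_codesGE_le : (codesGE 10 5 3).ncard ≤ 987813872640 := by
  have hle := ncard_codesGE_three_mul_card_linearEquiv_le (V := Fin 5 → ZMod 3) (n := 10) (k := 5)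
    (by rw [Module.finrank_fin_fun])
  have hcount : tupleCount 5 10 5 = 987813872640 * 475566474240 := by decide +kernel
  rw [Module.finrank_fin_fun, hcount, card_linearEquiv_eq] at hle
  exact Nat.le_of_mul_le_mul_right hle (by norm_num)

theorem Certified.exists_equivalent (h : Certified lo hi 987813872640 l)
    {C : Submodule (ZMod 3) (Fin 10 → ZMod 3)} (hC : C ∈ codesGE 10 5 3) :
    ∃ a ∈ l, Equivalent (codeOf a) C := by
  have hcard : Nat.card (signedPermGroup 10) = 3715891200 := by
    rw [card_signedPermGroup]; rfl
  have hmass : ∑ a : l.toFinset, Nat.card (signedPermGroup 10) / stabilizerBound a =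
      987813872640 := by
    rw [hcard, ← h.2.2, ← List.sum_toFinset _ h.nodup_map.of_map]
    exact Finset.sum_coe_sort _ orbitBound
  have hmem : ∀ a : l.toFinset, a.1 ∈ l := fun a => List.mem_toFinset.1 a.2
  obtain ⟨a, g, hg⟩ := exists_smul_eq_of_ncard_le (G := signedPermGroup 10)
    (Set.toFinite (codesGE 10 5 3)) (fun g _ => smul_mem_codesGE g)
    (fun a : l.toFinset => codeOf a)
    (fun a => ⟨finrank_codeOf a, (hasMinWeightGE_codeOf_iff a (by norm_num) (by norm_num)).2
      (h.2.1 a (hmem a))⟩)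
    (fun a b g hg => Subtype.ext (h.eq_of_equivalent (hmem a) (hmem b)
      (equivalent_iff_exists_smul_eq.2 ⟨g, hg⟩)))
    (fun a => stabilizerBound a) (fun a => card_stabilizer_codeOf_le a)
    (ncard_codesGE_le.trans hmass.ge) hC
  exact ⟨a, hmem a, equivalent_iff_exists_smul_eq.2 ⟨g, hg⟩⟩

theorem Certified.natCard_codeClass (h : Certified lo hi 987813872640 l) {d : ℕ} (h3 : 3 ≤ d)
    (hd : d < 32) : Nat.card (CodeClass 10 5 d) = l.countP (MinWeightTest · d) := by
  have hmin : ∀ a, IsMinWeight (codeOf a) d ↔ MinWeightTest a d := fun a =>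
    isMinWeight_codeOf_iff (by omega) hd
  have hmem : ∀ a, a ∈ (l.filter (MinWeightTest · d)).toFinset ↔ a ∈ l ∧ MinWeightTest a d := by
    simp
  rw [List.countP_eq_length_filter,
    ← List.toFinset_card_of_nodup (h.nodup_map.of_map.filter _), ← Fintype.card_coe,
    ← Nat.card_eq_fintype_card]
  refine natCard_codeClass_eq (fun a => ⟨codeOf a, finrank_codeOf _,
    (hmin a).2 ((hmem a).1 a.2).2⟩) (fun a b hab => Subtype.ext
      (h.eq_of_equivalent ((hmem a).1 a.2).1 ((hmem b).1 b.2).1 hab)) fun ⟨C, hC, hCd⟩ => ?_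
  obtain ⟨a, ha, haC⟩ := h.exists_equivalent ⟨hC, (isMinWeight_iff.1 hCd).1.mono h3⟩
  exact ⟨⟨a, (hmem a).2 ⟨ha, (hmin a).1 (haC.symm.isMinWeight hCd)⟩⟩, haC⟩

end Certificates

section Representatives

/-- The first block of the list `representatives`, which is divided because the kernel keeps all
values that occur in the check of one certificate in memory. -/
def representatives₁ : List ℕ := [
  510971723199, 409566993597, 489892942620, 555949171782, 510620975055, 542581600599, 532164294117,
  552597379713, 486218680560, 563487957855, 538866023679, 465642168831, 409566179547, 412995795525,
  472457488986, 409566187809, 461997628344, 377880358329, 542002153005, 563490166239, 493321151385,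
  549397331424, 525018538674, 489892963761, 433971245457, 510971748471, 510625767501, 493523217063,
  539168594643, 377924534514, 409552114221, 510971743854, 556370922339, 409552669719, 409364939340,
  493465821678, 433916448228, 409552645662, 496866532563, 409595716440, 493321042035, 448051550949,
  409552468515, 531963409419, 534972132630, 493320974238, 479244647142, 493465844034, 563632003152,
  461998692684, 423586309248, 535478892120, 454837463487, 510971751630, 409552772508, 409479790617,
  409596189561, 493638017067, 409610479662, 409566060963, 510756102252, 493480433997, 409624825410,
  409552075827, 448036303428, 409552846137, 535465329561, 549110549628, 461939386104, 409624824924,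
  510813675999, 409552963020, 409552962777, 524890107828, 409551897708, 531541619739, 472440361374,
  562768926444, 539111613087, 489700267920, 507209957082, 416582260470, 461940150096, 517727706885,
  479370883941, 462156763698, 409595278311, 531560052261, 409595691654, 517208842593, 489892971051,
  409508772502, 532166797515, 531950678175, 524961143050, 500160562570, 514500789853, 472266346655,
  542581601340, 472271903340, 556544704772, 538515250273, 392075443425, 542583218265, 476146162416,
  556372517921, 472271680058, 548975603476, 528476625759, 472271385536, 500382199267, 504099449692,
  556342202666, 546128343075, 392075048299, 472501561989, 427131027382, 555949172278, 563545353736,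
  563677530950, 381614693644, 472271562933, 486347189437, 486619337781, 511014796257, 563057548240,
  489704825430, 447516616348, 525075934312, 539082084955, 409581836816, 409552232566, 444376814314,
  409509208048]

theorem certified_representatives₁ :
    Certified 0 (675 * 10 ^ 11) 34753259520 representatives₁ := by
  decide +kernel

def representatives₂ : List ℕ := [
  535550634472, 500165345782, 556672782046, 525163645165, 409610298437, 556646091899, 556502137101,
  493321231908, 563676347751, 409566543127, 409509560806, 377751867715, 552467471439, 377883788043,
  528562718715, 556587751495, 524572723110, 556674859071, 560044220671, 542653345139, 409552906988,
  528664896570, 542655730434, 377751690568, 538515427420, 542324034240, 465469587586, 377983757757,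
  378111127911, 496851652948, 409552966282, 507268963075, 525032887348, 392075048336, 409509666985,
  542669725047, 426942704956, 500160799254, 542207000818, 409552966277, 493192445467, 409524205723,
  563473609201, 409566365981, 461897715016, 377865892549, 409494074890, 555953728765, 378084677593,
  511015448873, 542653345138, 461810547265, 556083931810, 531545996424, 559570961187, 420113761327,
  377867019360, 542668606055, 514644278918, 525034623099, 514644278923, 542581600609, 552595725130,
  497154108519, 378056166191, 409552961810, 468785002295, 528059451379, 548980346371, 454837167548,
  545695336588, 377912498765, 462013276585, 531676631858, 549110372971, 559585072902, 524568171955,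
  517828383276, 377927014587, 525033798861, 524774630128, 556502257143, 546170858355, 527798926949,
  552597338174, 378056166187, 377866309058, 409494147571, 419969145898, 419969145169, 409508969842,
  437403895083, 525162027754, 455010240136, 517988123696, 409567133617, 556084358761, 409235857527,
  378113375445, 402478229920, 500496811230, 409623819175, 409624586812, 524573686192, 409552906931,
  556286129287, 444376814345, 377869146568, 377912498776, 542208548711, 538650019768, 409566899561,
  555953719531, 462041970995, 535595891036, 455111215963, 559570726174, 528664837521, 542595950248,
  531546291669, 525018538678, 514113092851, 490137079669, 461810547296, 493594983715, 524760277314,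
  419969144446, 539067741988, 542567251940, 409610479999, 377867021790, 532164299718, 409307539099]

theorem certified_representatives₂ :
    Certified (675 * 10 ^ 11) (767 * 10 ^ 11) 107548492800 representatives₂ := by
  decide +kernel

def representatives₃ : List ℕ := [
  500164815558, 560176043348, 409192810804, 528189902114, 378026806665, 528189846903, 493609331407,
  486449408421, 461810540704, 409178398945, 563675050404, 377912547329, 535653404761, 416482351754,
  546142691974, 409624824491, 378084674920, 461997142845, 510971750187, 377984410240, 378027868332,
  535435271972, 409551881199, 531949616100, 493321231665, 542669668919, 493465842373, 555953725372,
  482860463356, 461997922385, 500640297874, 514112323982, 545494387462, 521216336973, 528189905952,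
  377866899548, 514107759467, 542612742762, 542453189972, 441020534380, 409624532941, 500496805317,
  531717946627, 409566425027, 521214726514, 475758641607, 409625005509, 556629736401, 510625587693,
  496980793846, 563201710692, 486218748612, 378110360514, 479288590789, 461810547292, 493653388522,
  556614831900, 542624647330, 419969913997, 521085940896, 409566899560, 465297922650, 539166561960,
  486651125421, 545623888189, 524568231010, 535595713888, 546142345317, 507269200101, 548980867831,
  420069103438, 493480191274, 514241099149, 531546234808, 451350382654, 510755924965, 493609332465,
  409524144439, 378113373987, 500293962039, 378113373984, 454836978715, 535552667167, 514515687454,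
  503652916795, 409235800422, 482731856116, 556600500526, 507269199126, 538850904756, 479417780764,
  419984201923, 444377581230, 409176510590, 555953728792, 461810549965, 555953728796, 528189845751,
  409566959339, 556672783122, 461810545817, 377883730938, 420098344138, 409235798979, 472616868559,
  556600487369, 546125781855, 535033966900, 472617115454, 524573682493, 549110549664, 514242054406,
  555953726119, 538866010568, 514241098906, 493609333383, 531963409429, 472617117478, 441063340927,
  531963965007, 419939963300, 556084241677, 556371868441, 545493610580, 409552903052, 493508891095,
  486564851403, 409595713312, 553115670287, 461810549969, 500654646537, 493552831347, 542137044099,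
  409551897493, 378113374713]

theorem certified_representatives₃ :
    Certified (767 * 10 ^ 11) (818 * 10 ^ 11) 137327124480 representatives₃ := by
  decide +kernel

def representatives₄ : List ℕ := [
  535163652445, 441020292037, 378084677140, 496823485147, 409508970547, 409566188345, 503782355431,
  409567137214, 377984468803, 419969145193, 559571085171, 476118467212, 409595122843, 528188719869,
  409594886158, 378113076528, 531546294342, 395561821042, 454965761911, 493580634844, 538520807441,
  479575570953, 563533449166, 556586134079, 412995804278, 531545875167, 549629003991, 524702761906,
  437562505864, 409235857531, 479374861623, 503651971507, 497153513472, 409235798235, 409235798478,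
  419997359908, 472559662480, 556616921701, 451350383383, 409581604252, 420113578294, 419969145175,
  461997910741, 548980344444, 556658434152, 409624704895, 420128051436, 542324034484, 437605726999,
  378114330188, 472444699684, 510755983772, 500496805318, 535494270646, 556370908044, 454967073886,
  528189605356, 532166029878, 507269199857, 409235857284, 517729493764, 419983071485, 416626855604,
  409567255345, 538693065772, 549110549402, 535278976375, 409625006540, 493320744619, 517729552569,
  409551526905, 409624410645, 546142691983, 545494387425, 409610476593, 420027604918, 556601805229,
  500654645026, 378084677624, 528448482961, 510626532233, 409595406619, 490123502109, 549672641207,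
  549628121242, 409552419702, 475758700656, 504140898457, 392075449743, 451350679121, 409623220688,
  409623220654, 486218746183, 409207159714, 524703062569, 549341379315, 497024614109, 552597323835,
  409624458727, 539080467545, 419969145901, 419969145155, 493509606750, 535364814589, 552595725373,
  409552428943, 454836977986, 552466952395, 409624591989, 409566057595, 493436617299, 409624104711,
  378084677620, 500160740449, 378084673472, 378084672500, 479475839631, 489835261750, 493639098757,
  497153513470, 486608078943, 493321160137, 535033317361, 409207159715, 392075568327, 517599274348,
  511158043258, 472400099194, 556487722489, 486346820791, 535365422881, 486607066527, 521215918698,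
  539067739233, 560046074278]

theorem certified_representatives₄ :
    Certified (818 * 10 ^ 11) (861 * 10 ^ 11) 140352307200 representatives₄ := by
  decide +kernel

def representatives₅ : List ℕ := [
  409551884601, 409552784675, 535033089197, 409551651553, 469087587436, 409551886074, 489833667427,
  542006768317, 517729493525, 409596189177, 500468110005, 556514389550, 493322048339, 560046310474,
  556242312649, 409566900047, 556631624901, 528190025336, 524573681041, 378084381658, 507269140564,
  493653447661, 528190022803, 535033799553, 549540839483, 409580230576, 378113549402, 556516597450,
  461998687618, 409552610470, 409566543856, 409551897496, 409552962867, 549153418994, 489705531070,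
  409580233504, 539124957688, 409566423569, 493639043130, 409552302550, 556603104307, 535278733048,
  409235794573, 542481886080, 378084673474, 409610475616, 493653149908, 409594934713, 556614831899,
  535593683380, 500293964014, 556629737067, 493322048095, 430430149880, 553085001750, 409625006547,
  535566846321, 479373256850, 479375157666, 378027458421, 524702820955, 552467118847, 465427724980,
  409524144470, 500468107504, 500293964021, 514574213520, 409235797994, 454967132935, 409162043101,
  556672783059, 528189906258, 559571080468, 535394061643, 479416902358, 493638030959, 472559661543,
  493321808960, 560118468352, 409596068880, 489833670355, 535278739852, 468784293973, 493465844039,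
  490108672478, 468785016911, 409596186211, 409595894357, 409552609703, 556486407157, 511115891320,
  563576083275, 511158872840, 462127832146, 378113552598, 556370922146, 419983072733, 479417141470,
  493652379136, 556084238519, 510626427540, 531832921108, 556079912111, 409479791132, 392075568571,
  528188837719, 542006766859, 419969145172, 500295215426, 507269139832, 378027459150, 409235797993,
  483149933307, 539066909442, 500598318595, 500640297873, 493623680597, 493638031014, 514242709366,
  535033975209, 472401591224, 409566543850, 409235857041, 563100556366, 458452546312, 556328640354,
  497153512684, 461997921933, 409624824733, 461997272393, 461810245711, 549368633611, 531676808032,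
  409623939484, 560044221160]

theorem certified_representatives₅ :
    Certified (861 * 10 ^ 11) (913 * 10 ^ 11) 136329338880 representatives₅ := by
  decide +kernel

def representatives₆ : List ℕ := [
  507269199371, 409551532023, 461998338473, 493653388612, 514515687491, 493609515202, 549583886915,
  531963668955, 409625065843, 546099172870, 549627470275, 549629240189, 409178343073, 462142716440,
  563617650392, 497110649004, 500295557848, 542526061816, 472401591782, 479416182800, 378113550645,
  510971745837, 409610658374, 521086058509, 535163416402, 493595995680, 441020415793, 556672784031,
  409596186933, 531676627149, 542511830942, 524946815570, 539094835918, 486348310624, 486635763657,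
  528189846972, 514242709363, 549109180813, 486607898073, 409596245260, 549110553567, 409624824975,
  535652873320, 409596127162, 409552847437, 409624828187, 556588460083, 514242585866, 486607066770,
  531676035709, 493594984480, 409235800199, 521216278408, 493523239946, 514242585856, 542625379564,
  479416186468, 437591083872, 419997362591, 556400150669, 528189906019, 507269140561, 486348313125,
  392075627134, 472616866141, 528478301730, 409596070836, 535378469539, 535033325670, 556328643337,
  514242708634, 535378472212, 409610478789, 409523014246, 535033314472, 538650374062, 517728118774,
  409551948985, 461996787332, 524703121376, 409624410659, 448035477727, 535494270730, 462099369864,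
  493638862505, 548980336151, 409624591990, 553099350657, 493480193037, 409610479761, 461940645118,
  409235800192, 409596185968, 560176161446, 409552015124, 486607066339, 409523013517, 535032726420,
  409192810078, 409553024300, 378113550402, 447993805417, 409192809349, 409596071710, 560089246968,
  535378467038, 409552724690, 535032726881, 409552610471, 409624828180, 493321646411, 524775162562,
  493322048338, 493480193277, 409235798479, 528190025577, 409624828087, 409236044417, 535667163186,
  441020415550, 493320453989, 493523236759, 493652380891, 549110790778, 493465831415, 409552962829,
  409553024841, 553171649549, 500496807508, 409594995018, 535665445203, 535653404774, 535552726228,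
  542178836646, 500295438021]

theorem certified_representatives₆ :
    Certified (913 * 10 ^ 11) (984 * 10 ^ 11) 132094771200 representatives₆ := by
  decide +kernel

def representatives₇ : List ℕ := [
  409595360494, 552855973616, 493320877325, 444507317808, 549110549680, 409609883875, 524703061838,
  556342210189, 510755924723, 409551771398, 493320453745, 500295556389, 517729493766, 409624824976,
  556082808677, 562922681544, 489833667400, 409580233249, 489833667158, 493508876192, 500496807577,
  419969726686, 378084913589, 409235798236, 409552962822, 535206521972, 409552550896, 472400279787,
  479417778118, 514443950285, 409624824732, 409551771392, 507269140322, 447993984352, 409595581588,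
  517729494498, 409595004985, 500353323621, 493638031198, 535639114912, 493321173836, 549369189193,
  521216277926, 409551771391, 409552478274, 539168954160, 514242408946, 493321041323, 556084122808,
  479375041928, 409553024846, 489950359960, 472266582841, 559714751876, 500295558310, 419969373122,
  528663160810, 479375041520, 560089061950, 472401473126, 486606515373, 521590592434, 493638626305,
  507269139833, 493321514219, 555953187853, 500160562326, 531963410646, 409552783737, 556084237060,
  409610474369, 493480611178, 468913445084, 517729488577, 496678401044, 562922681296, 489700208875,
  535523733166, 493494540436, 427073394499, 493610164742, 545695863602, 500295558344, 493321648112,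
  409553024356, 489833670344, 427073394569, 409553023813, 409596186210, 409552725868, 528189846952,
  409624824977, 458583655334, 409321950241, 409596069371, 409553025566, 545421985124, 472440371581,
  514588562014, 556614830920, 556399597806, 525119536379, 489314389300, 524572128238, 531676627903,
  409552017316, 542001974890, 458454159176, 559570907300, 409596245222, 427073095889, 409551602500,
  552462328093, 528189847700, 409596245259, 378099033574, 513882199091, 556487604387, 409509029595,
  553070651617, 423586314928, 339382481422, 506793838067, 409553024599, 532164294118, 409552962581,
  535609770562, 542006057784, 535466219444, 556672226548, 409551897739, 517599107431, 423570177480,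
  423455928613]

theorem certified_representatives₇ :
    Certified (984 * 10 ^ 11) (1132 * 10 ^ 11) 86864762880 representatives₇ := by
  decide +kernel

def representatives₈ : List ℕ := [
  409552906159, 538866677453, 545952006236, 542006057541, 552467466082, 542581617381, 542624647329,
  479239855672, 318461775016, 412995811578, 535509325214, 409595952880, 556543087362, 388198291180,
  513925244833, 444376093333, 556084000909, 493321233034, 496808604049, 377969351035, 409509735781,
  472443514057, 392117373316, 552480946056, 458324008815, 465355150389, 553041953811, 388401006397,
  542006050738, 377737998005, 556184386549, 454492072066, 506748548208, 549555186207, 409551897967,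
  539123513287, 541632985009, 360320196151, 563373188793, 532006461981, 563057784192, 381269599628,
  496850047974, 531560239650, 545954496286, 447473035533, 377737110088, 416582260482, 493637478345,
  528593506326, 377840210854, 521576772705, 556645385817, 556084215390, 420099760561, 528189940182,
  328922306855, 308001421822, 510625774842, 437403057672, 514113149722, 496852182202, 507209957094,
  332584115909, 556588223883, 329068276705, 528216756958, 552093340161, 556629179827, 413109825012,
  549397331433, 559540422409, 524975491711, 413066847549, 545952006751, 423065308287, 489700504854,
  468784184871, 423586311277, 506748607257, 556616921697, 542666106313, 413038079716, 409552313968,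
  454664263086, 287081249062, 377926307977, 539007135009, 542179257510, 548980344193, 339485582461,
  531675030917, 454880271132, 409509563466, 490051695826, 549110549386, 458366276929, 542668419431,
  539123515236, 409178222281, 409163877512, 409509265791, 507426736206, 479387426439, 524573681085,
  490166487089, 528534019922, 409235617909, 461939155987, 461996550412, 513882201793, 524572132864,
  559570940742, 419969380415, 531430911399, 549037022484, 433542670527, 413111783838, 514097431745,
  448136284845, 548975780622, 546041777238, 556616744550, 562969808990, 482859990220, 538995040194,
  409364947649, 549686045325, 353329619035, 552597156885, 308001421826, 416627325102, 437403235303,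
  556184386306]

theorem certified_representatives₈ :
    Certified (1132 * 10 ^ 11) (1282 * 10 ^ 11) 57960161280 representatives₈ := by
  decide +kernel

def representatives₉ : List ℕ := [
  409117811995, 493320215596, 539150625561, 504097848842, 420027543666, 437316431113, 517899892099,
  545593283561, 465354914193, 559436134068, 413095476103, 524572137238, 409595716441, 513738709784,
  412995752558, 556660322712, 556198735456, 420099583462, 489892971157, 486360995239, 486260553141,
  503794917220, 490077362893, 517209491905, 552999632466, 409436692184, 556084156341, 503881847590,
  556545177162, 454506420972, 409524124998, 563329074045, 559570881693, 541616982711, 562928013245,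
  406121907305, 409595657149, 420097989139, 559915079530, 556082337487, 539152937210, 563215350816,
  458454211826, 478854036336, 503708893068, 409118818994, 528476625019, 556084234114, 420097989119,
  489876476728, 556614832869, 461479989758, 482544185251, 549022671382, 409523357361, 409566415260,
  486535837875, 485973574750, 360607177704, 447922055073, 420099052004, 500496807738, 521300583058,
  563057666094, 493321173742, 552462565023, 556672227525, 556528738455, 378027525255, 451407835638,
  409118941236, 416524868037, 388343613960, 549194858266, 514242053653, 420099052000, 517684658494,
  503825691991, 493465844131, 468929209215, 531588996513, 503911194943, 409552254676, 409580771748,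
  504155126361, 556356573433, 489833430739, 482529837079, 457933565884, 496924349634, 493320217783,
  461939158660, 539095541583, 503766938236, 538691458584, 493638017839, 559570903561, 538591016706,
  535534699531, 538980750338, 433526312739, 391830395923, 455010769417, 535665444208, 549541604926,
  535032488740, 412822850277, 506748489160, 517729487593, 539164973006, 511141557613, 538692414064,
  531676630783, 413109825009, 521259675030, 479244656177, 525162027753, 510972402252, 556285895505,
  409118228504, 409408053402, 409566591921, 475757871782, 388487347002, 486002271838, 510913461558,
  531689438865, 458338357722, 339442535740, 493187229472, 563043335931, 556674789717, 535667635569,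
  556113168142]

theorem certified_representatives₉ :
    Certified (1282 * 10 ^ 11) (1404 * 10 ^ 11) 70918041600 representatives₉ := by
  decide +kernel

def representatives₁₀ : List ℕ := [
  517670310322, 542651757407, 527771940115, 552982970669, 531541917658, 472397323404, 493320215384,
  388197700721, 514242230831, 447878004519, 507642324105, 409567072381, 503939892756, 549110547202,
  507613315464, 503782054771, 409595289733, 413095476102, 461939149426, 461939153567, 461939154539,
  486188808365, 447936403980, 556082332627, 409118938806, 521013605653, 500294728695, 539107577380,
  521560452096, 409465203119, 514241167955, 496907443110, 413081127196, 409264564332, 528188305558,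
  521216158755, 409465205788, 521216456428, 506748489161, 461939156014, 552812919529, 413081127197,
  503723172694, 416524864144, 475685408431, 493638027070, 510971751747, 538129371158, 493637479803,
  479240151643, 409624707315, 549051369931, 503694957505, 451364847969, 556356573190, 507397979343,
  535536894558, 514429120921, 504111961543, 503780814761, 535624470756, 549238683567, 559570903318,
  545765472174, 483060746639, 556082337514, 479576157258, 535478790342, 514242939419, 493379755290,
  504155539704, 528534746038, 409624822291, 409551296318, 559988676694, 528189906022, 517209432856,
  409119055672, 461939158691, 475699758079, 556082337518, 556084108954, 413095476104, 461939156018,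
  549628702183, 409552963115, 381283951233, 454966010275, 458338298673, 409551949034, 542481883622,
  462156770122, 556082334841, 454851514272, 503939951805, 539009271003, 409178227388, 475887779571,
  409624710474, 539038145959, 503895359578, 535175976860, 465427783620, 493594433082, 458338180575,
  409553022164, 549022674063, 546083283168, 423586611378, 506748548209, 538650194039, 531676625233,
  451364670822, 461939158687, 349902891624, 409608691703, 409465200668, 409552771780, 489489056975,
  538992786124, 513722648456, 493638030676, 535606444066, 409465201640, 517729487606, 409524143745,
  409551542483, 409596012415, 542338383392, 409594994488, 535464543214, 409551542492, 409552488279,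
  409553022070, 528532432921]

theorem certified_representatives₁₀ :
    Certified (1404 * 10 ^ 11) (1601 * 10 ^ 11) 68240793600 representatives₁₀ := by
  decide +kernel

def representatives₁₁ : List ℕ := [
  409553024986, 538650374059, 381283949287, 409552785236, 409553024500, 549110547236, 542001796527,
  409553021584, 423586316137, 559435718532, 339383250540, 461419399891, 450959046682, 541805168958,
  532178643025, 539152211100, 413066775351, 402144599920, 325435815747, 548721346032, 308001421093,
  416281652244, 461996548220, 542002211085, 517208544201, 461997565191, 462156766961, 552609895926,
  559943777343, 507310396528, 461419399892, 412708052676, 549151809340, 542638995501, 559741302706,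
  468957966066, 531541857882, 448035064884, 507123865854, 528476624292, 423065011083, 521228839248,
  541919960212, 546023747614, 556084234099, 489489054038, 412908937375, 409623043761, 563444278632,
  426552799315, 420126437596, 553026017403, 552610617651, 423312616674, 562922740344, 461996550666,
  409595716684, 562855018455, 462156763789, 419578580974, 503981450104, 402319444013, 409118941209,
  538476222532, 325436349375, 524242106788, 409565642047, 381398741748, 374425171488, 532062687582,
  356816461756, 524568050938, 534642585508, 531541619740, 472440656620, 339385140112, 462157420625,
  283594464905, 489700267929, 447662003277, 521228849466, 493321150657, 504110603416, 517211145277,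
  538691469280, 395173691263, 433525123705, 552480768912, 409552822081, 409565655169, 283594109885,
  489892971168, 497050928019, 493321091608, 433973132847]

theorem certified_representatives₁₁ :
    Certified (1601 * 10 ^ 11) (4000 * 10 ^ 11) 15424819200 representatives₁₁ := by
  decide +kernel

/-- The numbers `a` of representatives `codeOf a` of the classes of codes of minimum weight at least
`3`, ordered by `coordMomentSum a`. -/
def representatives : List ℕ :=
  representatives₁ ++ representatives₂ ++ representatives₃ ++
  representatives₄ ++ representatives₅ ++ representatives₆ ++
  representatives₇ ++ representatives₈ ++ representatives₉ ++
  representatives₁₀ ++ representatives₁₁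

theorem certified_representatives :
    Certified 0 (4000 * 10 ^ 11) 987813872640 representatives := by
  rw [representatives]
  exact certified_representatives₁ |>.append certified_representatives₂
    |>.append certified_representatives₃ |>.append certified_representatives₄
    |>.append certified_representatives₅ |>.append certified_representatives₆
    |>.append certified_representatives₇ |>.append certified_representatives₈
    |>.append certified_representatives₉ |>.append certified_representatives₁₀
    |>.append certified_representatives₁₁

theorem natCard_codeClass {d : ℕ} (h3 : 3 ≤ d) (hd : d < 32) :
    Nat.card (CodeClass 10 5 d) = representatives.countP (MinWeightTest · d) :=
  certified_representatives.natCard_codeClass h3 hd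

theorem countP_representatives :
    representatives.countP (MinWeightTest · 4) = 135 ∧
      representatives.countP (MinWeightTest · 3) = 1303 := by
  decide +kernel

end Representatives

end TernaryCode

theorem mainTheorem2 :
    Nat.card (TernaryCode.CodeClass 10 5 4) = 135 ∧
      Nat.card (TernaryCode.CodeClass 10 5 3) = 1303 := by
  rw [TernaryCode.natCard_codeClass (by norm_num) (by norm_num),
    TernaryCode.natCard_codeClass le_rfl (by norm_num)]
  exact TernaryCode.countP_representatives
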